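/- For $N\ge 1$ let $A_N$ be the $N\times N$ complex Ginibre matrix, i.e. $A_N(j,k)=(X(j,k)+iY(j,k))/\sqrt{2N}$ for $1\le j,k\le N$, where the $X(j,k)$ and $Y(j,k)$ are independent real standard normal random variables, and let $\lambda_1,\dots,\lambda_N$ be the eigenvalues of $A_N$, counted with algebraic multiplicity. For every $N\ge1$ there is exactly one continuous function $\mathcal R_N^{(1)}:\mathbb C\to\mathbb R$, the one-point eigenvalue density, such that for every continuous, compactly supported function $f:\mathbb C\to\mathbb R$ $$\frac1N\,\mathbb E\Big[\sum_{k=1}^N f(\lambda_k)\Big]=\int_{\mathbb C} f(z)\,\mathcal R_N^{(1)}(z)\,d^2z,$$ where $d^2z$ is Lebesgue measure on $\mathbb C\cong\mathbb R^2$ and $\sum_{k=1}^N f(\lambda_k)$ is an integrable random variable. Moreover, for every $u\in\mathbb R$, $$\lim_{N\to\infty}\mathcal R_N^{(1)}\big(1-N^{-1/2}u\big)=\frac1\pi\,\Phi(2u),\qquad \Phi(x)=\frac1{\sqrt{2\pi}}\int_{-\infty}^{x}e^{-z^2/2}\,dz .$$ -/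

import Mathlib

open MeasureTheory ProbabilityTheory Filter Topology

noncomputable section

/-- The joint law of the `2N²` independent real standard normal variables `X(j,k)`, `Y(j,k)`;
a sample point `ω` has `ω j k = (X(j,k), Y(j,k))`. -/
def ginibreNoise (N : ℕ) : Measure (Fin N → Fin N → ℝ × ℝ) :=
  Measure.pi fun _ => Measure.pi fun _ => (gaussianReal 0 1).prod (gaussianReal 0 1)

/-- The `N × N` complex Ginibre matrix, with entries `(X(j,k) + i Y(j,k)) / √(2N)`. -/
def ginibreMatrix (N : ℕ) (ω : Fin N → Fin N → ℝ × ℝ) : Matrix (Fin N) (Fin N) ℂ :=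
  Matrix.of fun j k =>
    (((ω j k).1 : ℂ) + ((ω j k).2 : ℂ) * Complex.I) / ((Real.sqrt (2 * (N : ℝ)) : ℝ) : ℂ)

/-- The linear eigenvalue statistic `∑ₖ f(λₖ)`, where `λ₁, …, λ_N` are the eigenvalues of `A`
repeated according to their algebraic multiplicity. -/
def eigenvalueSum {N : ℕ} (A : Matrix (Fin N) (Fin N) ℂ) (f : ℂ → ℝ) : ℝ :=
  (A.charpoly.roots.map f).sum

/-- `R` is the one-point eigenvalue density of the `N × N` complex Ginibre ensemble: the continuous
function with `(1/N) E[∑ₖ f(λₖ)] = ∫ f(z) R(z) d²z` for every continuous, compactly supported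
test function `f` (the expectation being one of an integrable variable). Continuity is what makes
the values of the density at single points meaningful. -/
def IsOnePointDensity (N : ℕ) (R : ℂ → ℝ) : Prop :=
  Continuous R ∧
    ∀ f : ℂ → ℝ, Continuous f → HasCompactSupport f →
      Integrable (fun ω => eigenvalueSum (ginibreMatrix N ω) f) (ginibreNoise N) ∧
      (1 / (N : ℝ)) * ∫ ω, eigenvalueSum (ginibreMatrix N ω) f ∂(ginibreNoise N) =
        ∫ z : ℂ, f z * R z

/-- The standard normal distribution function. -/
def stdNormalCDF (x : ℝ) : ℝ :=
  (1 / Real.sqrt (2 * Real.pi)) * ∫ z in Set.Iic x, Real.exp (-z ^ 2 / 2)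

end

noncomputable section

/-! The density is explicit: R_N(z) = π⁻¹ e^{-N|z|²} ∑_{k<N} (N|z|²)^k / k!, which is
`ginibreDensity`. It is found by a Kac–Rice argument rather than from the joint law of all the
eigenvalues.

Write N = n + 1 and fix all rows B of the matrix except the zeroth. A pair (λ, y) determines the
unique zeroth row r for which (1, y) is a left eigenvector with eigenvalue λ (`eigenChart`). The
real Jacobian of (λ, y) ↦ r is |χ'(λ)|², where χ is the characteristic polynomial. The area
inequality `lintegral_mul_abs_det_le` then bounds E ∑ f(λ_k] from below, for f ≥ 0, by an integral
over (λ, y, B). Gaussian density and Jacobian are invariant under unitary conjugation, so (1, y) can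
be rotated to (1, 0, …, 0) at the cost of the factor (1 + |y|²)^{-(n+1)}. The y-integral gives the
volume π^n / n!, and what remains is the second moment of det(λ - G) for an n × n Gaussian matrix G.
The result is E ∑ f(λ_k) ≥ N ∫ f R_N (`lintegral_ginibreDensity_le`).

No separate treatment of multiple eigenvalues, or of eigenvectors with vanishing zeroth coordinate,
is needed. There are N eigenvalues and R_N has mass 1, so both sides agree on constants. The
inequality for M + f and M - f therefore gives equality (`integral_eigenvalueSum_ginibreMatrix`).

At z = 1 - u/√N, π R_N(z) is the probability that a Poisson variable of mean (√N - u)² is less than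
N. Written as a Gamma tail and centred at √N in the square-root variable, it converges by Stirling's
formula and dominated convergence to a Gaussian tail of variance 1/4, which is Φ(2u)
(`tendsto_exp_mul_sum_poisson`). -/

/-! ### Tonelli's theorem and densities on finite powers. -/

theorem measurable_fin_cons {n : ℕ} {α : Type*} [MeasurableSpace α] :
    Measurable (fun q : α × (Fin n → α) => (Fin.cons q.1 q.2 : Fin (n + 1) → α)) := by
  refine measurable_pi_iff.2 fun i => ?_
  refine Fin.cases ?_ (fun j => ?_) i
  · simpa using measurable_fst
  · simpa [Function.comp_def] using (measurable_pi_apply j).comp measurable_snd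

theorem measurePreserving_fin_cons {n : ℕ} {α : Type*} [MeasurableSpace α] (μ : Measure α)
    [SigmaFinite μ] :
    MeasurePreserving (fun q : α × (Fin n → α) => (Fin.cons q.1 q.2 : Fin (n + 1) → α))
      (μ.prod (Measure.pi fun _ => μ)) (Measure.pi fun _ => μ) := by
  have h := (measurePreserving_piFinSuccAbove (fun _ : Fin (n + 1) => μ) 0).symm
  convert h using 1
  ext q i
  simp [MeasurableEquiv.piFinSuccAbove_symm_apply, Fin.insertNthEquiv]

/-- Tonelli's theorem for the splitting of the zeroth coordinate of a finite power. -/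
theorem lintegral_pi_fin_succ {n : ℕ} {α : Type*} [MeasurableSpace α] (μ : Measure α)
    [SigmaFinite μ] {F : (Fin (n + 1) → α) → ENNReal} (hF : Measurable F) :
    ∫⁻ x, F x ∂(Measure.pi fun _ => μ) =
      ∫⁻ a, ∫⁻ y, F (Fin.cons a y) ∂(Measure.pi fun _ : Fin n => μ) ∂μ := by
  rw [← (measurePreserving_fin_cons μ).lintegral_comp hF,
    lintegral_prod (fun q => F (Fin.cons q.1 q.2))
      (hF.comp measurable_fin_cons).aemeasurable]

theorem lintegral_pi_fin_succ_symm {n : ℕ} {α : Type*} [MeasurableSpace α] (μ : Measure α)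
    [SigmaFinite μ] {F : (Fin (n + 1) → α) → ENNReal} (hF : Measurable F) :
    ∫⁻ x, F x ∂(Measure.pi fun _ => μ) =
      ∫⁻ y, ∫⁻ a, F (Fin.cons a y) ∂μ ∂(Measure.pi fun _ : Fin n => μ) := by
  rw [← (measurePreserving_fin_cons μ).lintegral_comp hF,
    lintegral_prod_symm (fun q => F (Fin.cons q.1 q.2))
      (hF.comp measurable_fin_cons).aemeasurable]

theorem lintegral_pi_fin_prod {n : ℕ} {α : Type*} [MeasurableSpace α] (μ : Measure α)
    [SigmaFinite μ] {f : Fin n → α → ENNReal} (hf : ∀ i, Measurable (f i)) :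
    ∫⁻ x, ∏ i, f i (x i) ∂(Measure.pi fun _ => μ) = ∏ i, ∫⁻ a, f i a ∂μ := by
  induction n with
  | zero => simp
  | succ n ih =>
    rw [lintegral_pi_fin_succ μ (by fun_prop)]
    simp only [Fin.prod_univ_succ, Fin.cons_zero, Fin.cons_succ]
    have h (a : α) : ∫⁻ y : Fin n → α, f 0 a * ∏ i, f (Fin.succ i) (y i) ∂(Measure.pi fun _ => μ)
        = f 0 a * ∏ i : Fin n, ∫⁻ a, f i.succ a ∂μ := by
      rw [lintegral_const_mul _ (by fun_prop), ih fun i => hf i.succ]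
    simp_rw [h]
    rw [lintegral_mul_const _ (hf 0)]

theorem pi_withDensity_fin {n : ℕ} {α : Type*} [MeasurableSpace α] (μ : Measure α)
    [SigmaFinite μ] {f : α → ENNReal} (hf : Measurable f) [SigmaFinite (μ.withDensity f)] :
    Measure.pi (fun _ : Fin n => μ.withDensity f) =
      (Measure.pi fun _ => μ).withDensity fun x => ∏ i, f (x i) := by
  refine (Measure.pi_eq fun s hs => ?_)
  rw [withDensity_apply _ (.univ_pi hs), ← lintegral_indicator (.univ_pi hs)]
  have h (x : Fin n → α) : (Set.univ.pi s).indicator (fun x => ∏ i, f (x i)) x =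
      ∏ i, (s i).indicator f (x i) := by
    by_cases hx : x ∈ Set.univ.pi s
    · rw [Set.indicator_of_mem hx]
      exact Finset.prod_congr rfl fun i _ => (Set.indicator_of_mem (hx i trivial) f).symm
    · rw [Set.indicator_of_notMem hx]
      obtain ⟨i, hi⟩ : ∃ i, x i ∉ s i := by simpa [Set.mem_pi] using hx
      exact (Finset.prod_eq_zero (Finset.mem_univ i) (Set.indicator_of_notMem hi f)).symm
  simp_rw [h]
  rw [lintegral_pi_fin_prod μ fun i => hf.indicator (hs i)]
  exact Finset.prod_congr rfl fun i _ => by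
    rw [lintegral_indicator (hs i), withDensity_apply _ (hs i)]

/-! ### Complex Gaussian arrays and the law of the Ginibre matrix. -/

/-- The density of the centred complex Gaussian variable with `E|g|² = 1/c`. -/
def complexGaussianPDF (c : ℝ) (z : ℂ) : ℝ := c / Real.pi * Real.exp (-c * ‖z‖ ^ 2)

theorem complexGaussianPDF_nonneg {c : ℝ} (hc : 0 < c) (z : ℂ) : 0 ≤ complexGaussianPDF c z := by
  unfold complexGaussianPDF; positivity

theorem continuous_complexGaussianPDF (c : ℝ) : Continuous (complexGaussianPDF c) := by
  unfold complexGaussianPDF; fun_prop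

/-- The law of the centred complex Gaussian variable with `E|g|² = 1/c`. -/
def complexGaussian (c : ℝ) : Measure ℂ :=
  volume.withDensity fun z => ENNReal.ofReal (complexGaussianPDF c z)

theorem map_gaussianReal_prod_eq_complexGaussian {c : ℝ} (hc : 0 < c) :
    ((gaussianReal 0 1).prod (gaussianReal 0 1)).map
      (fun q : ℝ × ℝ => ((q.1 : ℂ) + (q.2 : ℂ) * Complex.I) / ((Real.sqrt (2 * c) : ℝ) : ℂ)) =
      complexGaussian c := by
  set s := Real.sqrt (2 * c) with hs
  have hspos : 0 < s := Real.sqrt_pos.2 (by positivity)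
  have hs2 : s ^ 2 = 2 * c := Real.sq_sqrt (by positivity)
  -- Real and imaginary part each carry variance 1/(2c), half of E|g|² = 1/c.
  set v : NNReal := 1 / NNReal.mk (s ^ 2) (sq_nonneg _) with hv
  have hvr : (v : ℝ) = 1 / (2 * c) := by rw [hv, ← hs2]; rfl
  have hv0 : v ≠ 0 := by
    intro h
    rw [h] at hvr
    have : (0:ℝ) < 1 / (2 * c) := by positivity
    simp at hvr
    linarith
  have h1 : (gaussianReal 0 1).map (· / s) = gaussianReal 0 v := by
    rw [gaussianReal_map_div_const]; simp [hv]
  have hfun : (fun q : ℝ × ℝ => ((q.1 : ℂ) + (q.2 : ℂ) * Complex.I) / (s : ℂ)) =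
      Complex.measurableEquivRealProd.symm ∘ Prod.map (· / s) (· / s) := by
    funext q
    apply Complex.ext
    · simp [Complex.div_ofReal_re]
    · simp [Complex.div_ofReal_im]
  rw [hfun, ← Measure.map_map (MeasurableEquiv.measurable _) (by fun_prop),
    ← Measure.map_prod_map _ _ (by fun_prop) (by fun_prop), h1,
    gaussianReal_of_var_ne_zero _ hv0, prod_withDensity (measurable_gaussianPDF _ _)
      (measurable_gaussianPDF _ _)]
  ext t ht
  rw [MeasurableEquiv.map_apply, complexGaussian, withDensity_apply _ ht,
    withDensity_apply _ (Complex.measurableEquivRealProd.symm.measurable ht),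
    ← Complex.volume_preserving_equiv_real_prod.symm.setLIntegral_comp_preimage ht
      (continuous_complexGaussianPDF c).measurable.ennreal_ofReal]
  refine setLIntegral_congr_fun (Complex.measurableEquivRealProd.symm.measurable ht) fun q _ => ?_
  simp only [gaussianPDF, gaussianPDFReal, complexGaussianPDF]
  rw [← ENNReal.ofReal_mul (by positivity)]
  congr 1
  have hn : ‖Complex.measurableEquivRealProd.symm q‖ ^ 2 = q.1 ^ 2 + q.2 ^ 2 := by
    rw [← Complex.normSq_eq_norm_sq, Complex.normSq_apply]
    simp [sq]
  have hsq : (√(2 * Real.pi * (1 / (2 * c))))⁻¹ * (√(2 * Real.pi * (1 / (2 * c))))⁻¹ =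
      c / Real.pi := by
    rw [← mul_inv, Real.mul_self_sqrt (by positivity)]
    field_simp
  rw [hn, hvr, mul_mul_mul_comm, hsq, ← Real.exp_add]
  congr 2
  field_simp
  ring

instance complexGaussian_sigmaFinite (c : ℝ) : SigmaFinite (complexGaussian c) := by
  unfold complexGaussian
  infer_instance

theorem isProbabilityMeasure_complexGaussian {c : ℝ} (hc : 0 < c) :
    IsProbabilityMeasure (complexGaussian c) := by
  rw [← map_gaussianReal_prod_eq_complexGaussian hc]
  exact Measure.isProbabilityMeasure_map (by fun_prop)

/-- The density of a rectangular array of independent complex Gaussian variables. -/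
def matrixGaussianPDF (c : ℝ) {m n : ℕ} (A : Fin m → Fin n → ℂ) : ℝ :=
  ∏ i, ∏ j, complexGaussianPDF c (A i j)

theorem matrixGaussianPDF_nonneg {c : ℝ} (hc : 0 < c) {m n : ℕ} (A : Fin m → Fin n → ℂ) :
    0 ≤ matrixGaussianPDF c A :=
  Finset.prod_nonneg fun _ _ => Finset.prod_nonneg fun _ _ => complexGaussianPDF_nonneg hc _

theorem continuous_matrixGaussianPDF (c : ℝ) (m n : ℕ) :
    Continuous (matrixGaussianPDF c : (Fin m → Fin n → ℂ) → ℝ) := by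
  unfold matrixGaussianPDF
  have := continuous_complexGaussianPDF c
  fun_prop

theorem pi_complexGaussian {c : ℝ} (hc : 0 < c) (m n : ℕ) :
    (Measure.pi fun _ : Fin m => Measure.pi fun _ : Fin n => complexGaussian c) =
      volume.withDensity fun A : Fin m → Fin n → ℂ => ENNReal.ofReal (matrixGaussianPDF c A) := by
  have hm : Measurable fun z => ENNReal.ofReal (complexGaussianPDF c z) :=
    (continuous_complexGaussianPDF c).measurable.ennreal_ofReal
  have := isProbabilityMeasure_complexGaussian hc
  have h1 : (Measure.pi fun _ : Fin n => complexGaussian c) =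
      volume.withDensity fun x : Fin n → ℂ => ∏ j, ENNReal.ofReal (complexGaussianPDF c (x j)) := by
    have : SigmaFinite (volume.withDensity fun z => ENNReal.ofReal (complexGaussianPDF c z)) :=
      complexGaussian_sigmaFinite c
    exact pi_withDensity_fin volume hm
  have h2 : SigmaFinite (volume.withDensity
      fun x : Fin n → ℂ => ∏ j, ENNReal.ofReal (complexGaussianPDF c (x j))) := by
    rw [← h1]; infer_instance
  have hm2 : Measurable fun x : Fin n → ℂ => ∏ j, ENNReal.ofReal (complexGaussianPDF c (x j)) :=
    Finset.measurable_prod _ fun j _ => hm.comp (measurable_pi_apply j)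
  rw [h1]
  refine (pi_withDensity_fin volume hm2).trans ?_
  simp only [matrixGaussianPDF]
  congr 1
  funext A
  rw [ENNReal.ofReal_prod_of_nonneg fun i _ =>
    Finset.prod_nonneg fun _ _ => complexGaussianPDF_nonneg hc _]
  refine Finset.prod_congr rfl fun i _ => ?_
  rw [ENNReal.ofReal_prod_of_nonneg fun j _ => complexGaussianPDF_nonneg hc _]

/-- The entries of the Ginibre matrix are independent complex Gaussian variables. -/
theorem map_ginibreMatrix {N : ℕ} (hN : 1 ≤ N) :
    (ginibreNoise N).map (fun ω j k => ginibreMatrix N ω j k) =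
      Measure.pi fun _ : Fin N => Measure.pi fun _ : Fin N => complexGaussian N := by
  have hc : (0 : ℝ) < N := by exact_mod_cast hN
  have := isProbabilityMeasure_complexGaussian hc
  set φ : ℝ × ℝ → ℂ := fun q =>
    ((q.1 : ℂ) + (q.2 : ℂ) * Complex.I) / ((Real.sqrt (2 * (N : ℝ)) : ℝ) : ℂ) with hφ
  have hm : Measurable φ := by fun_prop
  have h0 := map_gaussianReal_prod_eq_complexGaussian hc
  have h1 : (Measure.pi fun _ : Fin N => (gaussianReal 0 1).prod (gaussianReal 0 1)).map
      (fun x k => φ (x k)) = Measure.pi fun _ : Fin N => complexGaussian N := by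
    rw [← h0]
    have : SigmaFinite (((gaussianReal 0 1).prod (gaussianReal 0 1)).map φ) := by
      rw [h0]; infer_instance
    exact Measure.pi_map_pi fun _ => hm.aemeasurable
  rw [← h1]
  have : SigmaFinite ((Measure.pi fun _ : Fin N => (gaussianReal 0 1).prod (gaussianReal 0 1)).map
      (fun x k => φ (x k))) := by
    rw [h1]; infer_instance
  exact Measure.pi_map_pi (f := fun _ : Fin N => fun (x : Fin N → ℝ × ℝ) k => φ (x k))
    fun _ => (measurable_pi_iff.2 fun k => hm.comp (measurable_pi_apply k)).aemeasurable

theorem map_ginibreMatrix_eq_withDensity {N : ℕ} (hN : 1 ≤ N) :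
    (ginibreNoise N).map (fun ω j k => ginibreMatrix N ω j k) =
      volume.withDensity fun A : Fin N → Fin N → ℂ => ENNReal.ofReal (matrixGaussianPDF N A) := by
  rw [map_ginibreMatrix hN, pi_complexGaussian (by exact_mod_cast hN)]

/-! ### Eigenvalue lists and continuity of linear statistics. -/

/-- Gershgorin's theorem. The bound is continuous in A, hence confines the eigenvalues of nearby
matrices to a compact set. -/
theorem norm_le_sum_norm_of_isRoot_charpoly {N : ℕ} {A : Matrix (Fin N) (Fin N) ℂ} {z : ℂ}
    (hz : A.charpoly.IsRoot z) : ‖z‖ ≤ ∑ i, ∑ j, ‖A i j‖ := by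
  have h1 : Module.End.HasEigenvalue (Matrix.toLin' A) z := by
    rw [Module.End.hasEigenvalue_iff_isRoot_charpoly, Matrix.charpoly_toLin']
    exact hz
  obtain ⟨k, hk⟩ := eigenvalue_mem_ball h1
  rw [mem_closedBall_iff_norm] at hk
  calc ‖z‖ ≤ ‖A k k‖ + ‖z - A k k‖ := norm_le_norm_add_norm_sub' z (A k k)
    _ ≤ ‖A k k‖ + ∑ j ∈ Finset.univ.erase k, ‖A k j‖ := by gcongr
    _ = ∑ j, ‖A k j‖ := Finset.add_sum_erase _ (fun j => ‖A k j‖) (Finset.mem_univ k)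
    _ ≤ ∑ i, ∑ j, ‖A i j‖ := Finset.single_le_sum (f := fun i => ∑ j, ‖A i j‖)
      (fun i _ => Finset.sum_nonneg fun j _ => norm_nonneg _) (Finset.mem_univ k)

theorem card_roots_charpoly {N : ℕ} (A : Matrix (Fin N) (Fin N) ℂ) :
    A.charpoly.roots.card = N := by
  rw [IsAlgClosed.card_roots_eq_natDegree, Matrix.charpoly_natDegree_eq_dim, Fintype.card_fin]

/-- The eigenvalues of a matrix, listed with their algebraic multiplicities. -/
theorem exists_map_univ_eq_roots_charpoly {N : ℕ} (A : Matrix (Fin N) (Fin N) ℂ) :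
    ∃ v : Fin N → ℂ, Finset.univ.val.map v = A.charpoly.roots := by
  obtain ⟨l, hl⟩ := Quot.exists_rep A.charpoly.roots
  have hlen : l.length = N := by
    rw [← card_roots_charpoly A, ← hl]; rfl
  subst hlen
  refine ⟨l.get, ?_⟩
  rw [← hl]
  simp [Fin.univ_val_map]

theorem eigenvalueSum_eq_sum {N : ℕ} {A : Matrix (Fin N) (Fin N) ℂ} {v : Fin N → ℂ}
    (hv : Finset.univ.val.map v = A.charpoly.roots) (f : ℂ → ℝ) :
    eigenvalueSum A f = ∑ i, f (v i) := by
  rw [eigenvalueSum, ← hv, Multiset.map_map]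
  rfl

theorem prod_X_sub_C_eq_charpoly {N : ℕ} {A : Matrix (Fin N) (Fin N) ℂ} {v : Fin N → ℂ}
    (hv : Finset.univ.val.map v = A.charpoly.roots) :
    ∏ i, (Polynomial.X - Polynomial.C (v i)) = A.charpoly := by
  conv_rhs => rw [(IsAlgClosed.splits A.charpoly).eq_prod_roots_of_monic A.charpoly_monic, ← hv,
    Multiset.map_map]
  rfl

/-- Linear eigenvalue statistics of continuous functions depend continuously on the matrix. -/
theorem continuous_eigenvalueSum {N : ℕ} {f : ℂ → ℝ} (hf : Continuous f) :
    Continuous fun A : Matrix (Fin N) (Fin N) ℂ => eigenvalueSum A f := by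
  choose v hv using fun A : Matrix (Fin N) (Fin N) ℂ => exists_map_univ_eq_roots_charpoly A
  -- The lists `v B` are ordered arbitrarily, but along an ultrafilter they converge by compactness.
  -- Passing to the limit in ∏ (t - v B i) = det(t - B) shows that the limit lists the eigenvalues
  -- of A.
  rw [continuous_iff_ultrafilter]
  intro A g hg
  have hcont : Continuous fun A : Matrix (Fin N) (Fin N) ℂ => ∑ i, ∑ j, ‖A i j‖ := by fun_prop
  have hb : ∀ᶠ B in (g : Filter (Matrix (Fin N) (Fin N) ℂ)),
      v B ∈ Set.pi Set.univ fun _ => Metric.closedBall (0 : ℂ) (∑ i, ∑ j, ‖A i j‖ + 1) := by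
    have h1 := (hcont.tendsto A).mono_left hg
    filter_upwards [h1.eventually (gt_mem_nhds (lt_add_one _))] with B hB i _
    rw [mem_closedBall_zero_iff]
    refine (norm_le_sum_norm_of_isRoot_charpoly (A := B) ?_).trans hB.le
    refine Polynomial.isRoot_of_mem_roots ?_
    rw [← hv B]
    exact Multiset.mem_map_of_mem _ (Finset.mem_univ_val i)
  have hK : IsCompact (Set.pi Set.univ fun _ : Fin N =>
      Metric.closedBall (0 : ℂ) (∑ i, ∑ j, ‖A i j‖ + 1)) :=
    isCompact_univ_pi fun _ => isCompact_closedBall _ _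
  obtain ⟨w, -, hw⟩ := hK.ultrafilter_le_nhds (g.map v) (le_principal_iff.2 hb)
  have hw' : Tendsto v g (𝓝 w) := hw
  have hpoly : ∏ i, (Polynomial.X - Polynomial.C (w i)) = A.charpoly := by
    refine Polynomial.funext fun t => ?_
    have h1 : Tendsto (fun B => ∏ i, (t - v B i)) g (𝓝 (∏ i, (t - w i))) :=
      tendsto_finsetProd _ fun i _ => tendsto_const_nhds.sub ((tendsto_pi_nhds.1 hw') i)
    have h2 : Continuous fun B : Matrix (Fin N) (Fin N) ℂ => (Matrix.scalar (Fin N) t - B).det :=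
      by fun_prop
    have h3 := (h2.tendsto A).mono_left hg
    have h4 (B : Matrix (Fin N) (Fin N) ℂ) :
        ∏ i, (t - v B i) = (Matrix.scalar (Fin N) t - B).det := by
      rw [← Matrix.eval_charpoly, ← prod_X_sub_C_eq_charpoly (hv B), Polynomial.eval_prod]
      simp
    simp_rw [h4] at h1
    rw [Matrix.eval_charpoly, ← tendsto_nhds_unique h1 h3, Polynomial.eval_prod]
    simp
  have hwr : Finset.univ.val.map w = A.charpoly.roots := by
    rw [← hpoly]
    exact (Polynomial.roots_multiset_prod_X_sub_C (Finset.univ.val.map w)).symm.trans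
      (by rw [Multiset.map_map]; rfl)
  rw [eigenvalueSum_eq_sum hwr]
  simp_rw [fun B => eigenvalueSum_eq_sum (hv B) f]
  exact tendsto_finsetSum _ fun i _ => (hf.tendsto _).comp ((tendsto_pi_nhds.1 hw') i)

/-! ### The area inequality. -/

/-- Superadditivity of the lower integral requires no measurability, so none has to be assumed of
`h` and `K` in the area inequality. -/
theorem finset_sum_lintegral_le {α ι : Type*} [MeasurableSpace α] (μ : Measure α) (s : Finset ι)
    (f : ι → α → ENNReal) : ∑ i ∈ s, ∫⁻ a, f i a ∂μ ≤ ∫⁻ a, ∑ i ∈ s, f i a ∂μ := by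
  classical
  induction s using Finset.induction_on with
  | empty => simp
  | insert i s hi ih =>
    simp only [Finset.sum_insert hi]
    exact (add_le_add_right ih _).trans (le_lintegral_add _ _)

/-- One half of the area formula for maps that need not be injective: a bound on the sums of `h`
over the regular points of the fibres of `g` bounds the integral of `h` times the Jacobian. -/
theorem lintegral_mul_abs_det_le {E : Type*} [NormedAddCommGroup E] [NormedSpace ℝ E]
    [FiniteDimensional ℝ E] [MeasurableSpace E] [BorelSpace E] (μ : Measure E)
    [μ.IsAddHaarMeasure] {g : E → E} {g' : E → E →L[ℝ] E} (hg : ∀ x, HasFDerivAt g (g' x) x)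
    (hm : Measurable fun x => (g' x).det) {h K : E → ENNReal}
    (hK : ∀ r, ∀ T : Finset E, (∀ x ∈ T, g x = r ∧ (g' x).det ≠ 0) → ∑ x ∈ T, h x ≤ K r) :
    ∫⁻ x, ENNReal.ofReal |(g' x).det| * h x ∂μ ≤ ∫⁻ r, K r ∂μ := by
  classical
  set s : Set E := {x | (g' x).det ≠ 0} with hs
  have hsm : MeasurableSet s := (hm (measurableSet_singleton 0)).compl
  have hδ : ∀ A : E →L[ℝ] E, ∃ δ : NNReal, δ ≠ 0 ∧ (A.det ≠ 0 →
      ∀ (t : Set E) (f : E → E), ApproximatesLinearOn f A t δ → Set.InjOn f t) := by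
    intro A
    by_cases hA : A.det = 0
    · exact ⟨1, one_ne_zero, fun h => absurd hA h⟩
    · let B := A.toContinuousLinearEquivOfDetNeZero hA
      have hB : (B : E →L[ℝ] E) = A := A.coe_toContinuousLinearEquivOfDetNeZero hA
      rcases subsingleton_or_nontrivial E with hE | hE
      · exact ⟨1, one_ne_zero, fun _ t f _ x _ y _ _ => Subsingleton.elim _ _⟩
      · have hpos := B.nnnorm_symm_pos
        refine ⟨‖(B.symm : E →L[ℝ] E)‖₊⁻¹ / 2, by positivity, fun _ t f hf => ?_⟩
        rw [← hB] at hf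
        exact hf.injOn (Or.inr (NNReal.half_lt_self (by positivity)))
  choose δ hδ0 hδi using hδ
  obtain ⟨t, A, htd, htm, hst, happ, hA⟩ :=
    exists_partition_approximatesLinearOn_of_hasFDerivWithinAt g s g'
      (fun x _ => (hg x).hasFDerivWithinAt) δ hδ0
  have hinj (n : ℕ) : Set.InjOn g (s ∩ t n) := by
    intro x hx
    obtain ⟨y, hy, hAy⟩ := hA ⟨x, hx.1⟩ n
    exact hδi (A n) (hAy ▸ hy) _ g (happ n) hx
  have hmn (n : ℕ) : MeasurableSet (s ∩ t n) := hsm.inter (htm n)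
  have hun : s = ⋃ n, s ∩ t n := by
    rw [← Set.inter_iUnion, Set.inter_eq_left.2 hst]
  -- Critical points contribute nothing, since the Jacobian factor vanishes there.
  have h1 : ∫⁻ x, ENNReal.ofReal |(g' x).det| * h x ∂μ =
      ∑' n, ∫⁻ x in s ∩ t n, ENNReal.ofReal |(g' x).det| * h x ∂μ := by
    rw [← lintegral_iUnion hmn (fun i j hij => (htd hij).mono Set.inter_subset_right
      Set.inter_subset_right), ← hun, ← lintegral_indicator hsm]
    refine lintegral_congr fun x => ?_
    by_cases hx : x ∈ s
    · rw [Set.indicator_of_mem hx]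
    · rw [Set.indicator_of_notMem hx]
      have : (g' x).det = 0 := by simpa [hs] using hx
      simp [this]
  let e (n : ℕ) : E → E := Function.invFunOn g (s ∩ t n)
  have he (n : ℕ) {x : E} (hx : x ∈ s ∩ t n) : e n (g x) = x :=
    (hinj n).leftInvOn_invFunOn hx
  have h2 (n : ℕ) : ∫⁻ x in s ∩ t n, ENNReal.ofReal |(g' x).det| * h x ∂μ =
      ∫⁻ r, (g '' (s ∩ t n)).indicator (fun r => h (e n r)) r ∂μ := by
    rw [lintegral_indicator (measurable_image_of_fderivWithin (hmn n)
      (fun x _ => (hg x).hasFDerivWithinAt) (hinj n)),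
      lintegral_image_eq_lintegral_abs_det_fderiv_mul μ (hmn n)
      (fun x _ => (hg x).hasFDerivWithinAt) (hinj n)]
    exact setLIntegral_congr_fun (hmn n) fun x hx => by simp only [he n hx]
  rw [h1]
  simp_rw [h2]
  refine ENNReal.tsum_le_of_sum_range_le fun m => ?_
  refine (finset_sum_lintegral_le μ _ _).trans (lintegral_mono fun r => ?_)
  simp only [Set.indicator_apply, ← Finset.sum_filter]
  -- Each piece whose image contains r supplies one regular point of the fibre over r. The pieces
  -- are disjoint, so these points are distinct and `hK` applies to them.
  set I := (Finset.range m).filter fun n => r ∈ g '' (s ∩ t n) with hI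
  have hmem : ∀ n ∈ I, e n r ∈ s ∩ t n ∧ g (e n r) = r := by
    intro n hn
    obtain ⟨x, hx, rfl⟩ := (Finset.mem_filter.1 hn).2
    rw [he n hx]
    exact ⟨hx, rfl⟩
  have hinjI : Set.InjOn (fun n => e n r) I := by
    intro i hi j hj hij
    by_contra hne
    refine Set.disjoint_left.1 (htd hne) (hmem i hi).1.2 ?_
    have := (hmem j hj).1.2
    simp only at hij
    rwa [hij]
  have := hK r (I.image fun n => e n r) (by
    intro x hx
    obtain ⟨n, hn, rfl⟩ := Finset.mem_image.1 hx
    exact ⟨(hmem n hn).2, (hmem n hn).1.1⟩)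
  rwa [Finset.sum_image hinjI] at this

/-! ### The chart of left eigenvectors and its Jacobian. -/

/-- The characteristic matrix at `z` with its zeroth row replaced by `w`. -/
def reducedMatrix {n : ℕ} (z : ℂ) (A : Matrix (Fin (n + 1)) (Fin (n + 1)) ℂ)
    (w : Fin (n + 1) → ℂ) : Matrix (Fin (n + 1)) (Fin (n + 1)) ℂ :=
  (Matrix.scalar (Fin (n + 1)) z - A).updateRow 0 w

/-- As w₀ = 1, replacing the zeroth row of X - A by w(X - A) preserves the determinant. That row
equals (X - z)w, and the scalar factors out. -/
theorem charpoly_eq_mul_of_vecMul_eq {n : ℕ} {A : Matrix (Fin (n + 1)) (Fin (n + 1)) ℂ}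
    {w : Fin (n + 1) → ℂ} {z : ℂ} (hw : w 0 = 1) (h : Matrix.vecMul w A = z • w) :
    A.charpoly = (Polynomial.X - Polynomial.C z) *
      (A.charmatrix.updateRow 0 fun j => Polynomial.C (w j)).det := by
  have h1 := Matrix.det_updateRow_sum A.charmatrix 0 fun k => Polynomial.C (w k)
  rw [hw, map_one, one_smul] at h1
  have h2 : ∑ k, Polynomial.C (w k) • A.charmatrix k =
      (Polynomial.X - Polynomial.C z) • fun j => Polynomial.C (w j) := by
    funext j
    have hj := congrFun h j
    simp only [Matrix.vecMul, dotProduct, Pi.smul_apply, smul_eq_mul] at hj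
    have hk (k : Fin (n + 1)) : (Polynomial.C (w k) • A.charmatrix k) j =
        (if k = j then Polynomial.C (w k) * Polynomial.X else 0) -
          Polynomial.C (w k * A k j) := by
      rw [Pi.smul_apply, smul_eq_mul, Matrix.charmatrix_apply, Matrix.diagonal_apply, mul_sub,
        map_mul]
      split_ifs <;> simp
    rw [Finset.sum_apply, Finset.sum_congr rfl fun k _ => hk k, Finset.sum_sub_distrib,
      ← map_sum, hj, Finset.sum_ite_eq' Finset.univ j]
    simp only [Finset.mem_univ, if_true, Pi.smul_apply, smul_eq_mul, map_mul]
    ring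
  rw [Matrix.charpoly, ← h1, h2, Matrix.det_updateRow_smul]

/-- Differentiating the factorisation at z leaves only the cofactor of X - z. This identifies the
chart's Jacobian with |χ'(z)|², a conjugation-invariant quantity. -/
theorem eval_derivative_charpoly_of_vecMul_eq {n : ℕ}
    {A : Matrix (Fin (n + 1)) (Fin (n + 1)) ℂ}
    {w : Fin (n + 1) → ℂ} {z : ℂ} (hw : w 0 = 1) (h : Matrix.vecMul w A = z • w) :
    A.charpoly.derivative.eval z = (reducedMatrix z A w).det := by
  rw [charpoly_eq_mul_of_vecMul_eq hw h, Polynomial.derivative_mul]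
  simp only [Polynomial.derivative_sub, Polynomial.derivative_X, Polynomial.derivative_C, sub_zero,
    one_mul, Polynomial.eval_add, Polynomial.eval_mul, Polynomial.eval_sub, Polynomial.eval_X,
    Polynomial.eval_C, sub_self, zero_mul, add_zero]
  rw [← Polynomial.coe_evalRingHom, RingHom.map_det]
  congr 1
  ext i j
  rcases eq_or_ne i 0 with rfl | hi
  · simp [reducedMatrix]
  · simp [reducedMatrix, Matrix.updateRow_ne hi, Matrix.charmatrix_apply, Matrix.diagonal_apply,
      apply_ite]

/-- The row vector `(1, p₁, …, pₙ)`. -/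
def affineVec {n : ℕ} (p : Fin (n + 1) → ℂ) : Fin (n + 1) → ℂ := Fin.cons 1 (Fin.tail p)

/-- The zeroth row that makes `(1, p₁, …, pₙ)` a left eigenvector with eigenvalue `p₀` of the
matrix whose other rows are those of `B`. -/
def eigenChart {n : ℕ} (B : Fin n → Fin (n + 1) → ℂ) (p : Fin (n + 1) → ℂ) : Fin (n + 1) → ℂ :=
  fun j => p 0 * affineVec p j - ∑ i : Fin n, p i.succ * B i j

/-- The matrix with zeroth row `r` and other rows `B`. -/
def consMatrix {n : ℕ} (r : Fin (n + 1) → ℂ) (B : Fin n → Fin (n + 1) → ℂ) :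
    Matrix (Fin (n + 1)) (Fin (n + 1)) ℂ := Matrix.of (Fin.cons r B)

theorem consMatrix_zero {n : ℕ} (r : Fin (n + 1) → ℂ) (B : Fin n → Fin (n + 1) → ℂ)
    (j : Fin (n + 1)) : consMatrix r B 0 j = r j := rfl

theorem consMatrix_succ {n : ℕ} (r : Fin (n + 1) → ℂ) (B : Fin n → Fin (n + 1) → ℂ)
    (i : Fin n) (j : Fin (n + 1)) : consMatrix r B i.succ j = B i j := rfl

theorem affineVec_zero {n : ℕ} (p : Fin (n + 1) → ℂ) : affineVec p 0 = 1 := rfl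

theorem affineVec_succ {n : ℕ} (p : Fin (n + 1) → ℂ) (i : Fin n) :
    affineVec p i.succ = p i.succ := rfl

theorem vecMul_consMatrix_eq_iff {n : ℕ} {r : Fin (n + 1) → ℂ} {B : Fin n → Fin (n + 1) → ℂ}
    {p : Fin (n + 1) → ℂ} :
    Matrix.vecMul (affineVec p) (consMatrix r B) = p 0 • affineVec p ↔ eigenChart B p = r := by
  simp only [funext_iff]
  refine forall_congr' fun j => ?_
  simp only [Matrix.vecMul, dotProduct, Fin.sum_univ_succ, affineVec_zero, affineVec_succ,
    consMatrix_zero, consMatrix_succ, Pi.smul_apply, smul_eq_mul, eigenChart]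
  constructor <;> intro h
  · rw [← h]; ring
  · rw [← h]; ring

/-- The differential of `eigenChart B` at `p`. -/
def eigenChartDeriv {n : ℕ} (B : Fin n → Fin (n + 1) → ℂ) (p : Fin (n + 1) → ℂ) :
    (Fin (n + 1) → ℂ) →L[ℝ] (Fin (n + 1) → ℂ) :=
  (LinearMap.toContinuousLinearMap (Matrix.toLin'
    (reducedMatrix (p 0) (consMatrix 0 B) (affineVec p)).transpose)).restrictScalars ℝ

theorem reducedMatrix_consMatrix {n : ℕ} (z : ℂ) (r r' : Fin (n + 1) → ℂ)
    (B : Fin n → Fin (n + 1) → ℂ) (w : Fin (n + 1) → ℂ) :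
    reducedMatrix z (consMatrix r B) w = reducedMatrix z (consMatrix r' B) w := by
  ext i j
  refine Fin.cases ?_ (fun i => ?_) i
  · simp [reducedMatrix]
  · simp [reducedMatrix, consMatrix_succ]

/-- The partial derivative in p₀ is (1, p₁, …, pₙ), and the one in the coordinate `i.succ` is p₀
times the corresponding basis vector minus `B i`. These are the rows of the reduced matrix, hence
the transpose. -/
theorem hasFDerivAt_eigenChart {n : ℕ} (B : Fin n → Fin (n + 1) → ℂ) (p : Fin (n + 1) → ℂ) :
    HasFDerivAt (eigenChart B) (eigenChartDeriv B p) p := by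
  refine HasFDerivAt.restrictScalars ℝ ?_
  have hc (i : Fin (n + 1)) : HasFDerivAt (fun p : Fin (n + 1) → ℂ => p i)
      (ContinuousLinearMap.proj (R := ℂ) (φ := fun _ => ℂ) i) p := hasFDerivAt_apply i p
  rw [hasFDerivAt_pi']
  intro j
  have hs (j : Fin (n + 1)) := HasFDerivAt.fun_sum (u := Finset.univ)
    fun (i : Fin n) _ => (hc i.succ).mul_const (B i j)
  refine Fin.cases ?_ (fun k => ?_) j
  · refine (((hc 0).mul_const 1).sub (hs 0)).congr_fderiv ?_ |>.congr_of_eventuallyEq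
      (.of_forall fun q => rfl)
    ext h
    simp [reducedMatrix, Matrix.mulVec, dotProduct, Fin.sum_univ_succ, consMatrix_succ,
      affineVec_zero, Fin.succ_ne_zero, sub_eq_add_neg]
  · refine (((hc 0).mul (hc k.succ)).sub (hs k.succ)).congr_fderiv ?_ |>.congr_of_eventuallyEq
      (.of_forall fun q => rfl)
    ext h
    simp [reducedMatrix, Matrix.mulVec, dotProduct, Fin.sum_univ_succ, consMatrix_succ,
      affineVec_succ, Matrix.diagonal_apply, sub_mul, Finset.sum_sub_distrib]
    ring

theorem det_eigenChartDeriv {n : ℕ} (B : Fin n → Fin (n + 1) → ℂ) (p : Fin (n + 1) → ℂ) :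
    (eigenChartDeriv B p).det =
      ‖(reducedMatrix (p 0) (consMatrix 0 B) (affineVec p)).det‖ ^ 2 := by
  have h : (eigenChartDeriv B p).det = LinearMap.det ((Matrix.toLin'
    (reducedMatrix (p 0) (consMatrix 0 B) (affineVec p)).transpose).restrictScalars ℝ) := rfl
  rw [h, LinearMap.det_restrictScalars, LinearMap.det_toLin', Matrix.det_transpose,
    Algebra.norm_complex_apply, Complex.normSq_eq_norm_sq]

/-- The difference w - w' lies in the left kernel of z - A and has zeroth coordinate 0. It does not
see the replaced row, so it also lies in the left kernel of the reduced matrix. -/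
theorem eq_of_reducedMatrix_det_ne_zero {n : ℕ} {A : Matrix (Fin (n + 1)) (Fin (n + 1)) ℂ}
    {w w' : Fin (n + 1) → ℂ} {z : ℂ} (hw : w 0 = 1) (hw' : w' 0 = 1)
    (h : Matrix.vecMul w A = z • w) (h' : Matrix.vecMul w' A = z • w')
    (hd : (reducedMatrix z A w).det ≠ 0) : w = w' := by
  by_contra hne
  refine hd (Matrix.exists_vecMul_eq_zero_iff.1 ⟨w - w', sub_ne_zero.2 hne, ?_⟩)
  have h0 : (w - w') 0 = 0 := by simp [hw, hw']
  have h1 : Matrix.vecMul (w - w') (Matrix.scalar (Fin (n + 1)) z - A) = 0 := by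
    rw [Matrix.vecMul_sub, Matrix.sub_vecMul A, h, h', ← smul_sub]
    simp
  rw [← h1]
  funext j
  simp only [Matrix.vecMul, dotProduct]
  refine Finset.sum_congr rfl fun i _ => ?_
  rcases eq_or_ne i 0 with rfl | hi
  · rw [h0, zero_mul, zero_mul]
  · rw [reducedMatrix, Matrix.updateRow_ne hi]

/-- At regular points the eigenvalue determines the normalised eigenvector, so T injects into the
set of distinct eigenvalues. This is the fibre bound required by the area inequality. -/
theorem sum_le_sum_roots_of_eigenChart {n : ℕ} (B : Fin n → Fin (n + 1) → ℂ)
    (r : Fin (n + 1) → ℂ) (F : ℂ → ENNReal) (T : Finset (Fin (n + 1) → ℂ))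
    (hT : ∀ p ∈ T, eigenChart B p = r ∧ (eigenChartDeriv B p).det ≠ 0) :
    ∑ p ∈ T, F (p 0) ≤ ((consMatrix r B).charpoly.roots.map F).sum := by
  classical
  have hv (p) (hp : p ∈ T) := vecMul_consMatrix_eq_iff.2 (hT p hp).1
  have hd (p) (hp : p ∈ T) : (reducedMatrix (p 0) (consMatrix r B) (affineVec p)).det ≠ 0 := by
    have := (hT p hp).2
    rw [det_eigenChartDeriv, reducedMatrix_consMatrix _ 0 r] at this
    simpa using this
  have hinj : Set.InjOn (fun p : Fin (n + 1) → ℂ => p 0) T := by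
    intro p hp q hq hpq
    simp only at hpq
    have hq' := hv q hq
    rw [← hpq] at hq'
    have := eq_of_reducedMatrix_det_ne_zero (affineVec_zero p) (affineVec_zero q) (hv p hp) hq'
      (hd p hp)
    funext i
    refine Fin.cases hpq (fun k => ?_) i
    exact congrFun this k.succ
  rw [← Finset.sum_image (f := F) hinj]
  have hle : (T.image fun p => p 0).val ≤ (consMatrix r B).charpoly.roots := by
    refine (Multiset.le_iff_subset (Finset.nodup _)).2 fun z hz => ?_
    obtain ⟨p, hp, rfl⟩ := Finset.mem_image.1 hz
    rw [Polynomial.mem_roots (Matrix.charpoly_monic _).ne_zero,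
      charpoly_eq_mul_of_vecMul_eq (affineVec_zero p) (hv p hp)]
    simp [Polynomial.IsRoot]
  obtain ⟨u, hu⟩ := Multiset.le_iff_exists_add.1 hle
  rw [hu, Multiset.map_add, Multiset.sum_add]
  exact le_self_add

/-! ### Rotating the eigenvector by a unitary conjugation. -/

theorem exists_unitary_row_zero {n : ℕ} {w : Fin (n + 1) → ℂ} (hw : w 0 = 1) :
    ∃ Q ∈ Matrix.unitaryGroup (Fin (n + 1)) ℂ,
      ∀ j, Q 0 j = w j / ((Real.sqrt (∑ j, ‖w j‖ ^ 2) : ℝ) : ℂ) := by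
  set W := ∑ j, ‖w j‖ ^ 2 with hW
  have hWpos : 0 < W := by
    refine lt_of_lt_of_le (by norm_num : (0 : ℝ) < 1) ?_
    calc (1 : ℝ) = ‖w 0‖ ^ 2 := by simp [hw]
      _ ≤ W := Finset.single_le_sum (f := fun j => ‖w j‖ ^ 2) (fun _ _ => by positivity)
        (Finset.mem_univ 0)
  set v : EuclideanSpace ℂ (Fin (n + 1)) :=
    WithLp.toLp 2 fun j => w j / ((Real.sqrt W : ℝ) : ℂ) with hv
  have hvn : ‖v‖ = 1 := by
    rw [EuclideanSpace.norm_eq, Real.sqrt_eq_one]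
    simp only [hv, norm_div, div_pow, Complex.norm_real, Real.norm_eq_abs, sq_abs]
    rw [← Finset.sum_div, Real.sq_sqrt hWpos.le, ← hW, div_self hWpos.ne']
  have ho : Orthonormal ℂ (({0} : Set (Fin (n + 1))).domRestrict fun _ => v) := by
    rw [orthonormal_iff_ite]
    rintro ⟨i, rfl⟩ ⟨j, rfl⟩
    simp only [Set.domRestrict_apply, inner_self_eq_norm_sq_to_K, hvn]
    simp
  obtain ⟨b, hb⟩ := ho.exists_orthonormalBasis_extension_of_card_eq (by simp)
  refine ⟨Matrix.of fun i j => b i j, ?_, fun j => ?_⟩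
  · rw [Matrix.mem_unitaryGroup_iff]
    ext i k
    have := orthonormal_iff_ite.1 b.orthonormal k i
    rw [PiLp.inner_apply] at this
    simp only [Matrix.mul_apply, Matrix.star_apply, Matrix.of_apply, Matrix.one_apply]
    simp only [RCLike.inner_apply, RCLike.star_def] at this ⊢
    rw [this]
    simp [eq_comm]
  · simp [hb 0 rfl, hv]

theorem norm_det_of_mem_unitaryGroup {n : ℕ} {Q : Matrix (Fin n) (Fin n) ℂ}
    (hQ : Q ∈ Matrix.unitaryGroup (Fin n) ℂ) : ‖Q.det‖ = 1 :=
  CStarRing.norm_of_mem_unitary (Matrix.det_of_mem_unitary hQ)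

/-- Cramer's rule: the adjugate of Q* is det(Q*) Q, and |det Q*| = 1. -/
theorem norm_det_submatrix_star_unitary {n : ℕ} {Q : Matrix (Fin (n + 1)) (Fin (n + 1)) ℂ}
    (hQ : Q ∈ Matrix.unitaryGroup (Fin (n + 1)) ℂ) :
    ‖((star Q).submatrix Fin.succ Fin.succ).det‖ = ‖Q 0 0‖ := by
  have h1 : (star Q).adjugate = (star Q).det • Q := by
    have h := congrArg (· * Q) (Matrix.adjugate_mul (star Q))
    simpa [mul_assoc, Matrix.mem_unitaryGroup_iff'.1 hQ] using h
  have h2 := Matrix.adjugate_fin_succ_eq_det_submatrix (star Q) 0 0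
  rw [h1] at h2
  simp only [Matrix.smul_apply, smul_eq_mul, Fin.succAbove_zero, Fin.val_zero, add_zero, pow_zero,
    one_mul] at h2
  rw [← h2, norm_mul, norm_det_of_mem_unitaryGroup (Unitary.star_mem hQ), one_mul]

/-- The linear map `B ↦ P * B * Q` on rectangular arrays. -/
def mulMulLinear {m n : ℕ} (P : Matrix (Fin m) (Fin m) ℂ) (Q : Matrix (Fin n) (Fin n) ℂ) :
    (Fin m → Fin n → ℂ) →ₗ[ℂ] (Fin m → Fin n → ℂ) where
  toFun B := P * Matrix.of B * Q
  map_add' B C := by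
    change P * (Matrix.of B + Matrix.of C) * Q = P * Matrix.of B * Q + P * Matrix.of C * Q
    rw [Matrix.mul_add, Matrix.add_mul]
  map_smul' a B := by
    change P * (a • Matrix.of B) * Q = a • (P * Matrix.of B * Q)
    rw [Matrix.mul_smul, Matrix.smul_mul]

/-- P acts on each of the n columns, and the transpose of Q on each of the m rows. -/
theorem det_mulMulLinear {m n : ℕ} (P : Matrix (Fin m) (Fin m) ℂ)
    (Q : Matrix (Fin n) (Fin n) ℂ) :
    LinearMap.det (mulMulLinear P Q) = P.det ^ n * Q.det ^ m := by
  let e : (Fin n → Fin m → ℂ) ≃ₗ[ℂ] (Fin m → Fin n → ℂ) :=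
    Matrix.transposeLinearEquiv (Fin n) (Fin m) ℂ ℂ
  let R : (Fin m → Fin n → ℂ) →ₗ[ℂ] (Fin m → Fin n → ℂ) :=
    LinearMap.pi fun i => (Matrix.toLin' Q.transpose).comp (LinearMap.proj i)
  let L : (Fin n → Fin m → ℂ) →ₗ[ℂ] (Fin n → Fin m → ℂ) :=
    LinearMap.pi fun i => (Matrix.toLin' P).comp (LinearMap.proj i)
  have h : mulMulLinear P Q = R.comp ((e : _ →ₗ[ℂ] _).comp (L.comp (e.symm : _ →ₗ[ℂ] _))) := by
    refine LinearMap.ext fun B => ?_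
    funext i j
    change (P * Matrix.of B * Q) i j = Matrix.mulVec Q.transpose
      (fun k => Matrix.mulVec P (fun l => B l k) i) j
    rw [Matrix.mulVec_transpose]
    rfl
  rw [h, LinearMap.det_comp, LinearMap.det_conj, LinearMap.det_pi, LinearMap.det_pi]
  simp [mul_comm]

instance isAddHaarMeasure_volume_pi_pi_complex (m n : ℕ) :
    (volume : Measure (Fin m → Fin n → ℂ)).IsAddHaarMeasure := by
  have h : ∀ _ : Fin m, (volume : Measure (Fin n → ℂ)).IsAddHaarMeasure := fun _ => inferInstance
  have h2 : ∀ _ : Fin m, SigmaFinite (volume : Measure (Fin n → ℂ)) := fun _ => inferInstance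
  exact @Measure.pi.isAddHaarMeasure (Fin m) (fun _ => Fin n → ℂ) _ _ (fun _ => volume) h2 _ _ h _

theorem lintegral_comp_mulMulLinear {m n : ℕ} {P : Matrix (Fin m) (Fin m) ℂ}
    {Q : Matrix (Fin n) (Fin n) ℂ} (hP : P.det ≠ 0) (hQ : ‖Q.det‖ = 1)
    (v : Fin m → Fin n → ℂ) {G : (Fin m → Fin n → ℂ) → ENNReal} (hG : Measurable G) :
    ∫⁻ B, G B = ENNReal.ofReal (‖P.det‖ ^ (2 * n)) * ∫⁻ B, G (v + mulMulLinear P Q B) := by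
  have hd : LinearMap.det ((mulMulLinear P Q).restrictScalars ℝ) = ‖P.det‖ ^ (2 * n) := by
    rw [LinearMap.det_restrictScalars, det_mulMulLinear, Algebra.norm_complex_apply,
      Complex.normSq_eq_norm_sq, norm_mul, norm_pow, norm_pow, hQ, one_pow, mul_one, ← pow_mul,
      mul_comm]
  have hpos : 0 < ‖P.det‖ ^ (2 * n) := by positivity
  have hm : Measurable (mulMulLinear P Q) :=
    (LinearMap.continuous_of_finiteDimensional (mulMulLinear P Q)).measurable
  have hmap := Measure.map_linearMap_addHaar_eq_smul_addHaar
    (volume : Measure (Fin m → Fin n → ℂ)) (f := (mulMulLinear P Q).restrictScalars ℝ)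
    (by rw [hd]; exact hpos.ne')
  have h1 : ∫⁻ B, G (v + mulMulLinear P Q B) =
      ENNReal.ofReal |(‖P.det‖ ^ (2 * n))⁻¹| * ∫⁻ B, G (v + B) := by
    rw [← hd, ← smul_eq_mul, ← lintegral_smul_measure, ← hmap]
    exact (lintegral_map (hG.comp (measurable_const_add v)) hm).symm
  rw [h1, lintegral_add_left_eq_self G v, abs_of_pos (inv_pos.2 hpos), ← mul_assoc,
    ← ENNReal.ofReal_mul hpos.le, mul_inv_cancel₀ hpos.ne', ENNReal.ofReal_one, one_mul]

/-- The matrices with left eigenvector `(1, p₁, …, pₙ)` and eigenvalue `p₀` are unitarily conjugate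
to those with left eigenvector `(1, 0, …, 0)`; this is the effect on Lebesgue measure. -/
theorem lintegral_consMatrix_eigenChart {n : ℕ}
    {Φ : Matrix (Fin (n + 1)) (Fin (n + 1)) ℂ → ENNReal}
    (hΦ : Measurable fun A : Fin (n + 1) → Fin (n + 1) → ℂ => Φ (Matrix.of A))
    (hinv : ∀ Q ∈ Matrix.unitaryGroup (Fin (n + 1)) ℂ, ∀ A, Φ (star Q * A * Q) = Φ A)
    (p : Fin (n + 1) → ℂ) :
    ∫⁻ B, Φ (consMatrix (eigenChart B p) B) =
      ENNReal.ofReal ((∑ j, ‖affineVec p j‖ ^ 2)⁻¹ ^ (n + 1)) *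
        ∫⁻ B, Φ (consMatrix (Pi.single 0 (p 0)) B) := by
  set W := ∑ j, ‖affineVec p j‖ ^ 2 with hW
  have hWpos : 0 < W := by
    refine lt_of_lt_of_le (by norm_num : (0 : ℝ) < 1) ?_
    calc (1 : ℝ) = ‖affineVec p 0‖ ^ 2 := by simp [affineVec_zero]
      _ ≤ W := Finset.single_le_sum (f := fun j => ‖affineVec p j‖ ^ 2)
        (fun _ _ => by positivity) (Finset.mem_univ 0)
  obtain ⟨Q, hQ, hQ0⟩ := exists_unitary_row_zero (affineVec_zero p)
  rw [← hW] at hQ0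
  have hsq : ((Real.sqrt W : ℝ) : ℂ) ≠ 0 := by
    exact_mod_cast (Real.sqrt_pos.2 hWpos).ne'
  set P := (star Q).submatrix (Fin.succ : Fin n → _) Fin.succ with hP
  have hPn : ‖P.det‖ = (Real.sqrt W)⁻¹ := by
    rw [norm_det_submatrix_star_unitary hQ, hQ0, affineVec_zero, norm_div, norm_one,
      Complex.norm_real, Real.norm_of_nonneg (Real.sqrt_nonneg _), one_div]
  have hPd : P.det ≠ 0 := by
    rw [← norm_ne_zero_iff, hPn]
    exact inv_ne_zero (Real.sqrt_pos.2 hWpos).ne'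
  -- This is the contribution of the zeroth row (p₀, 0, …, 0) to the lower rows of the conjugated
  -- matrix; `B` contributes PBQ.
  let v : Fin n → Fin (n + 1) → ℂ := fun i j => star Q i.succ 0 * p 0 * Q 0 j
  have hcm : Measurable fun B : Fin n → Fin (n + 1) → ℂ =>
      Φ (consMatrix (eigenChart B p) B) := by
    refine hΦ.comp (g := fun A => Φ (Matrix.of A))
      (f := fun B : Fin n → Fin (n + 1) → ℂ => (Fin.cons (eigenChart B p) B)) ?_
    refine measurable_pi_iff.2 fun i => ?_
    refine Fin.cases ?_ (fun k => ?_) i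
    · simp only [Fin.cons_zero]
      unfold eigenChart
      fun_prop
    · simp only [Fin.cons_succ]
      fun_prop
  -- The lower rows agree by direct computation. The zeroth row then needs none: conjugation turns
  -- the left eigenvector e₀ into a multiple of (1, p₁, …, pₙ), and the eigenvector equation forces
  -- that row.
  have hkey (B : Fin n → Fin (n + 1) → ℂ) :
      consMatrix (eigenChart (v + mulMulLinear P Q B) p) (v + mulMulLinear P Q B) =
        star Q * consMatrix (Pi.single 0 (p 0)) B * Q := by
    set C := consMatrix (Pi.single 0 (p 0)) B with hC
    have hrows : ∀ i j, (star Q * C * Q) (Fin.succ i) j = (v + mulMulLinear P Q B) i j := by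
      intro i j
      change _ = v i j + (P * Matrix.of B * Q) i j
      simp only [Matrix.mul_apply, hC, Fin.sum_univ_succ (n := n), consMatrix_zero,
        consMatrix_succ, add_mul, Finset.sum_add_distrib, v, hP, Matrix.submatrix_apply,
        Matrix.of_apply, Pi.single_eq_same, Finset.sum_mul]
      simp [Fin.succ_ne_zero]
      ring
    have hM : consMatrix ((star Q * C * Q) 0) (v + mulMulLinear P Q B) = star Q * C * Q := by
      ext i j
      refine Fin.cases ?_ (fun k => ?_) i
      · rfl
      · rw [consMatrix_succ, hrows]
    have hw : affineVec p = ((Real.sqrt W : ℝ) : ℂ) • Matrix.vecMul (Pi.single 0 1) Q := by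
      funext j
      rw [Matrix.single_one_vecMul]
      simp only [Pi.smul_apply, smul_eq_mul, Matrix.row_apply, hQ0]
      field_simp
    have hCe : Matrix.vecMul (Pi.single 0 1) C = p 0 • (Pi.single 0 1 : Fin (n + 1) → ℂ) := by
      funext j
      rw [Matrix.single_one_vecMul]
      simp [hC, consMatrix_zero, Pi.single_apply]
    have heig : Matrix.vecMul (affineVec p) (star Q * C * Q) = p 0 • affineVec p := by
      rw [hw, Matrix.smul_vecMul, Matrix.vecMul_vecMul, ← mul_assoc, ← mul_assoc,
        Matrix.mem_unitaryGroup_iff.1 hQ, one_mul, ← Matrix.vecMul_vecMul, hCe,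
        Matrix.smul_vecMul, smul_comm]
    rw [← hM] at heig
    rw [vecMul_consMatrix_eq_iff.1 heig, hM]
  rw [lintegral_comp_mulMulLinear hPd (norm_det_of_mem_unitaryGroup hQ) v hcm]
  simp_rw [hkey, hinv Q hQ, hPn]
  -- Here |det P|² = W⁻¹, and B has n + 1 columns.
  rw [inv_pow, inv_pow, pow_mul, Real.sq_sqrt hWpos.le]

/-! ### Gaussian moments and the second moment of a characteristic determinant. -/

theorem integral_norm_sq_mul_exp {c : ℝ} (hc : 0 < c) (k : ℕ) :
    ∫ z : ℂ, ‖z‖ ^ (2 * k) * Real.exp (-c * ‖z‖ ^ 2) =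
      Real.pi * k.factorial / c ^ (k + 1) := by
  have h := Complex.integral_rpow_mul_exp_neg_mul_rpow (p := 2) (q := 2 * k) (b := c)
    (by norm_num) (by have : (0 : ℝ) ≤ k := k.cast_nonneg; linarith) hc
  have h2 : ((2 * (k : ℝ)) + 2) / 2 = (k : ℝ) + 1 := by ring
  have h3 : -(2 * (k : ℝ) + 2) / 2 = -((k + 1 : ℕ) : ℝ) := by push_cast; ring
  rw [h2, h3, Real.rpow_neg hc.le, Real.rpow_natCast, Real.Gamma_nat_eq_factorial] at h
  rw [show Real.pi * k.factorial / c ^ (k + 1) =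
    2 * Real.pi / 2 * (c ^ (k + 1))⁻¹ * k.factorial by field_simp, ← h]
  refine integral_congr_ae (.of_forall fun z => ?_)
  simp only
  norm_cast

theorem integrable_norm_sq_mul_exp {c : ℝ} (hc : 0 < c) (k : ℕ) :
    Integrable fun z : ℂ => ‖z‖ ^ (2 * k) * Real.exp (-c * ‖z‖ ^ 2) := by
  by_contra h
  have h1 := integral_norm_sq_mul_exp hc k
  -- A non-integrable function has integral 0 by convention, which contradicts the positive value
  -- just computed.
  rw [integral_undef h] at h1
  have : 0 < Real.pi * k.factorial / c ^ (k + 1) := by positivity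
  linarith

theorem integral_complexGaussian_eq {c : ℝ} (hc : 0 < c) {E : Type*} [NormedAddCommGroup E]
    [NormedSpace ℝ E] (f : ℂ → E) :
    ∫ z, f z ∂(complexGaussian c) = ∫ z, complexGaussianPDF c z • f z := by
  rw [complexGaussian, integral_withDensity_eq_integral_toReal_smul
    (continuous_complexGaussianPDF c).measurable.ennreal_ofReal (by simp)]
  simp_rw [ENNReal.toReal_ofReal (complexGaussianPDF_nonneg hc _)]

theorem integrable_norm_sq_complexGaussian {c : ℝ} (hc : 0 < c) :
    Integrable (fun z : ℂ => ‖z‖ ^ 2) (complexGaussian c) := by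
  rw [complexGaussian, integrable_withDensity_iff_integrable_smul'
    (continuous_complexGaussianPDF c).measurable.ennreal_ofReal (by simp)]
  simp_rw [ENNReal.toReal_ofReal (complexGaussianPDF_nonneg hc _)]
  refine ((integrable_norm_sq_mul_exp hc 1).const_mul (c / Real.pi)).congr
    (.of_forall fun z => ?_)
  simp [complexGaussianPDF]
  ring

theorem integral_norm_sq_complexGaussian {c : ℝ} (hc : 0 < c) :
    ∫ z : ℂ, ‖z‖ ^ 2 ∂(complexGaussian c) = c⁻¹ := by
  rw [integral_complexGaussian_eq hc]
  have h : ∀ z : ℂ, complexGaussianPDF c z • ‖z‖ ^ 2 =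
      c / Real.pi * (‖z‖ ^ (2 * 1) * Real.exp (-c * ‖z‖ ^ 2)) := fun z => by
    simp [complexGaussianPDF]; ring
  simp_rw [h]
  rw [integral_const_mul, integral_norm_sq_mul_exp hc]
  simp
  field_simp

theorem memLp_two_complexGaussian {c : ℝ} (hc : 0 < c) :
    MemLp (fun z : ℂ => z) 2 (complexGaussian c) :=
  (memLp_two_iff_integrable_sq_norm (by fun_prop)).2 (integrable_norm_sq_complexGaussian hc)

theorem integral_id_complexGaussian {c : ℝ} (hc : 0 < c) :
    ∫ z : ℂ, z ∂(complexGaussian c) = 0 := by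
  rw [integral_complexGaussian_eq hc]
  have h := integral_neg_eq_self (fun z : ℂ => complexGaussianPDF c z • z) volume
  have h2 : ∀ z : ℂ, complexGaussianPDF c (-z) • -z = -(complexGaussianPDF c z • z) := by
    intro z; simp [complexGaussianPDF]
  simp_rw [h2] at h
  rw [integral_neg] at h
  exact self_eq_neg.1 h.symm

theorem integral_star_complexGaussian {c : ℝ} (hc : 0 < c) :
    ∫ z : ℂ, star z ∂(complexGaussian c) = 0 := by
  have h := integral_conj (f := fun z : ℂ => z) (μ := complexGaussian c)
  rw [integral_id_complexGaussian hc, map_zero] at h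
  exact h

section Rows

variable {c : ℝ} {N : ℕ}

theorem integral_eval_pi_complexGaussian (hc : 0 < c) (f : ℂ → ℂ) (hf : Continuous f)
    (a : Fin N) :
    ∫ g : Fin N → ℂ, f (g a) ∂(Measure.pi fun _ => complexGaussian c) =
      ∫ z, f z ∂(complexGaussian c) := by
  have := isProbabilityMeasure_complexGaussian hc
  have h := measurePreserving_eval (fun _ : Fin N => complexGaussian c) a
  have h2 := integral_map (μ := Measure.pi fun _ : Fin N => complexGaussian c)
    h.measurable.aemeasurable (f := f) hf.aestronglyMeasurable
  rw [h.map_eq] at h2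
  exact h2.symm

theorem memLp_eval_pi_complexGaussian (hc : 0 < c) (a : Fin N) :
    MemLp (fun g : Fin N → ℂ => g a) 2 (Measure.pi fun _ => complexGaussian c) := by
  have := isProbabilityMeasure_complexGaussian hc
  exact (memLp_two_complexGaussian hc).comp_measurePreserving
    (measurePreserving_eval (fun _ : Fin N => complexGaussian c) a)

theorem integral_mul_star_pi_complexGaussian (hc : 0 < c) (a b : Fin N) :
    ∫ g : Fin N → ℂ, g a * star (g b) ∂(Measure.pi fun _ => complexGaussian c) =
      if a = b then (c : ℂ)⁻¹ else 0 := by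
  have := isProbabilityMeasure_complexGaussian hc
  split_ifs with hab
  · subst hab
    rw [integral_eval_pi_complexGaussian hc (fun z => z * star z) (by fun_prop) a]
    have h (z : ℂ) : z * star z = ((‖z‖ ^ 2 : ℝ) : ℂ) := by
      rw [Complex.star_def, Complex.mul_conj, Complex.normSq_eq_norm_sq]
    simp_rw [h]
    rw [integral_complex_ofReal, integral_norm_sq_complexGaussian hc]
    simp
  -- For a ≠ b the integrand is a product over independent coordinates, and the factor at a has mean
  -- zero.
  · let F : Fin N → ℂ → ℂ := fun k z => if k = a then z else if k = b then star z else 1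
    have hF (g : Fin N → ℂ) : g a * star (g b) = ∏ k, F k (g k) := by
      rw [Finset.prod_eq_mul a b hab]
      · simp [F, Ne.symm hab]
      · intro k _ hk
        simp [F, hk.1, hk.2]
      · simp
      · simp
    simp_rw [hF]
    rw [integral_fintype_prod_eq_prod]
    refine Finset.prod_eq_zero (Finset.mem_univ a) ?_
    simpa [F] using integral_id_complexGaussian hc

theorem memLp_sub_pi_complexGaussian (hc : 0 < c) (s : ℂ) (a : Fin N) :
    MemLp (fun g : Fin N → ℂ => s - g a) 2 (Measure.pi fun _ => complexGaussian c) := by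
  have := isProbabilityMeasure_complexGaussian hc
  exact (memLp_const s).sub (memLp_eval_pi_complexGaussian hc a)

theorem integrable_sub_mul_star_sub (hc : 0 < c) (s t : ℂ) (a b : Fin N) :
    Integrable (fun g : Fin N → ℂ => (s - g a) * star (t - g b))
      (Measure.pi fun _ => complexGaussian c) :=
  (memLp_sub_pi_complexGaussian hc s a).integrable_mul (memLp_sub_pi_complexGaussian hc t b).star

theorem integral_sub_mul_star_sub (hc : 0 < c) (s t : ℂ) (a b : Fin N) :
    ∫ g : Fin N → ℂ, (s - g a) * star (t - g b) ∂(Measure.pi fun _ => complexGaussian c) =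
      s * star t + if a = b then (c : ℂ)⁻¹ else 0 := by
  have := isProbabilityMeasure_complexGaussian hc
  have ha := (memLp_eval_pi_complexGaussian hc a)
  have hb := (memLp_eval_pi_complexGaussian hc b)
  have i1 : Integrable (fun g : Fin N → ℂ => g a) (Measure.pi fun _ => complexGaussian c) :=
    ha.integrable (by norm_num)
  have i2 : Integrable (fun g : Fin N → ℂ => star (g b)) (Measure.pi fun _ => complexGaussian c) :=
    hb.star.integrable (by norm_num)
  have i3 : Integrable (fun g : Fin N → ℂ => g a * star (g b))
      (Measure.pi fun _ => complexGaussian c) := ha.integrable_mul hb.star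
  have h (g : Fin N → ℂ) : (s - g a) * star (t - g b) =
      (s * star t - s * star (g b)) + (g a * star (g b) - g a * star t) := by
    rw [star_sub]; ring
  have j1 : Integrable (fun g : Fin N → ℂ => s * star t - s * star (g b))
      (Measure.pi fun _ => complexGaussian c) := (integrable_const _).sub (i2.const_mul s)
  have j2 : Integrable (fun g : Fin N → ℂ => g a * star (g b) - g a * star t)
      (Measure.pi fun _ => complexGaussian c) := i3.sub (i1.mul_const _)
  simp_rw [h]
  rw [integral_add j1 j2, integral_sub (integrable_const _) (i2.const_mul s), integral_sub i3 (i1.mul_const _),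
    integral_const, integral_const_mul, integral_mul_const, integral_mul_star_pi_complexGaussian hc,
    integral_eval_pi_complexGaussian hc (fun z => z) continuous_id a,
    integral_eval_pi_complexGaussian hc (fun z => star z) continuous_star b,
    integral_id_complexGaussian hc, integral_star_complexGaussian hc]
  simp

end Rows

theorem card_perm_fixing {n : ℕ} (S : Finset (Fin n)) :
    (Finset.univ.filter fun σ : Equiv.Perm (Fin n) => ∀ i ∈ S, σ i = i).card =
      (n - S.card).factorial := by
  have e := Equiv.Perm.subtypeEquivSubtypePerm fun i : Fin n => i ∉ S
  rw [← Fintype.card_subtype]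
  have h := Fintype.card_congr e
  rw [Fintype.card_perm, Fintype.card_subtype_compl, Fintype.card_coe, Fintype.card_fin] at h
  rw [h]
  simp

/-- Expand the product over the set S of indices at which x is chosen. Such a term survives only if
σ fixes S pointwise, which leaves (n - |S|)! permutations. -/
theorem sum_perm_prod_add {n : ℕ} (x v : ℝ) :
    ∑ σ : Equiv.Perm (Fin n), ∏ i, ((if σ i = i then x else 0) + v) =
      ∑ k ∈ Finset.range (n + 1), (n.choose k) * (x ^ k * v ^ (n - k) * (n - k).factorial) := by
  have h1 (σ : Equiv.Perm (Fin n)) : ∏ i, ((if σ i = i then x else 0) + v) =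
      ∑ S : Finset (Fin n), if ∀ i ∈ S, σ i = i then x ^ S.card * v ^ (n - S.card) else 0 := by
    rw [Finset.prod_add]
    refine Finset.sum_congr (by simp) fun S _ => ?_
    rw [Finset.prod_const, Finset.card_sdiff_of_subset (Finset.subset_univ S)]
    simp only [Finset.card_univ, Fintype.card_fin]
    split_ifs with h
    · rw [Finset.prod_congr rfl fun i hi => if_pos (h i hi), Finset.prod_const]
    · push Not at h
      obtain ⟨i, hi, hne⟩ := h
      rw [Finset.prod_eq_zero hi (if_neg hne), zero_mul]
  simp_rw [h1]
  rw [Finset.sum_comm]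
  have h2 (S : Finset (Fin n)) : ∑ σ : Equiv.Perm (Fin n),
      (if ∀ i ∈ S, σ i = i then x ^ S.card * v ^ (n - S.card) else 0) =
      x ^ S.card * v ^ (n - S.card) * (n - S.card).factorial := by
    rw [← Finset.sum_filter, Finset.sum_const, card_perm_fixing, nsmul_eq_mul, mul_comm]
  simp_rw [h2]
  rw [← Finset.powerset_univ,
    Finset.sum_powerset_apply_card (fun k => x ^ k * v ^ (n - k) * ((n - k).factorial : ℝ))]
  simp

/-- The second moment of the characteristic polynomial of a Gaussian matrix. -/
theorem integral_norm_det_sq {c : ℝ} (hc : 0 < c) {n N : ℕ} (e : Fin n → Fin N)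
    (he : Function.Injective e) (z : ℂ) :
    Integrable (fun B : Fin n → Fin N → ℂ =>
        ‖(Matrix.of fun i j => (if i = j then z else 0) - B i (e j)).det‖ ^ 2)
      (Measure.pi fun _ => Measure.pi fun _ => complexGaussian c) ∧
    ∫ B : Fin n → Fin N → ℂ, ‖(Matrix.of fun i j => (if i = j then z else 0) - B i (e j)).det‖ ^ 2
        ∂(Measure.pi fun _ => Measure.pi fun _ => complexGaussian c) =
      ∑ σ : Equiv.Perm (Fin n), ∏ i, ((if σ i = i then ‖z‖ ^ 2 else 0) + c⁻¹) := by
  have := isProbabilityMeasure_complexGaussian hc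
  set μ : Measure (Fin n → Fin N → ℂ) :=
    Measure.pi fun _ => Measure.pi fun _ => complexGaussian c with hμ
  let s : Fin n → Fin n → ℂ := fun i j => if i = j then z else 0
  let q : Equiv.Perm (Fin n) → Equiv.Perm (Fin n) → Fin n → (Fin N → ℂ) → ℂ := fun σ τ i g =>
    (s i (σ i) - g (e (σ i))) * star (s i (τ i) - g (e (τ i)))
  have hq (σ τ) (i : Fin n) : Integrable (q σ τ i) (Measure.pi fun _ => complexGaussian c) :=
    integrable_sub_mul_star_sub hc _ _ _ _
  -- The double Leibniz expansion is organised by rows, so independence of the rows factorises each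
  -- expectation.
  have hexp (B : Fin n → Fin N → ℂ) :
      (((‖(Matrix.of fun i j => s i j - B i (e j)).det‖ ^ 2 : ℝ)) : ℂ) =
      ∑ σ : Equiv.Perm (Fin n), ∑ τ : Equiv.Perm (Fin n),
        (((Equiv.Perm.sign σ : ℤ) : ℂ) * ((Equiv.Perm.sign τ : ℤ) : ℂ)) * ∏ i, q σ τ i (B i) := by
    rw [← Complex.normSq_eq_norm_sq, ← Complex.mul_conj, ← Matrix.det_transpose,
      Matrix.det_apply', map_sum, Finset.sum_mul_sum]
    refine Finset.sum_congr rfl fun σ _ => Finset.sum_congr rfl fun τ _ => ?_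
    simp only [q, Finset.prod_mul_distrib, map_mul, map_prod, Matrix.transpose_apply,
      Matrix.of_apply, Complex.star_def, map_intCast]
    ring
  have hint (σ τ : Equiv.Perm (Fin n)) : Integrable (fun B : Fin n → Fin N → ℂ =>
      (((Equiv.Perm.sign σ : ℤ) : ℂ) * ((Equiv.Perm.sign τ : ℤ) : ℂ)) * ∏ i, q σ τ i (B i)) μ :=
    (Integrable.fintype_prod fun i => hq σ τ i).const_mul _
  have hval (σ τ : Equiv.Perm (Fin n)) : ∫ B : Fin n → Fin N → ℂ,
      (((Equiv.Perm.sign σ : ℤ) : ℂ) * ((Equiv.Perm.sign τ : ℤ) : ℂ)) * ∏ i, q σ τ i (B i) ∂μ =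
      if σ = τ then ((∏ i, ((if σ i = i then ‖z‖ ^ 2 else 0) + c⁻¹) : ℝ) : ℂ) else 0 := by
    rw [integral_const_mul, hμ, integral_fintype_prod_eq_prod]
    simp only [q, integral_sub_mul_star_sub hc]
    split_ifs with h
    · subst h
      rw [← Int.cast_mul, ← Units.val_mul, Int.units_mul_self, Units.val_one, Int.cast_one,
        one_mul, Complex.ofReal_prod]
      refine Finset.prod_congr rfl fun i _ => ?_
      by_cases hi : σ i = i
      · simp [s, hi, Complex.mul_conj, Complex.normSq_eq_norm_sq]
      · simp [s, hi, Ne.symm hi]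
    · obtain ⟨i, hi⟩ : ∃ i, σ i ≠ τ i := by
        by_contra hcon
        push Not at hcon
        exact h (Equiv.ext hcon)
      -- If σ i ≠ τ i, the two entries of row i are uncorrelated because `e` is injective, and at
      -- least one is off the diagonal and so has mean zero. Only σ = τ survives.
      rw [Finset.prod_eq_zero (Finset.mem_univ i), mul_zero]
      rw [if_neg fun h' => hi (he h'), add_zero]
      by_cases h1 : i = σ i
      · have h2 : i ≠ τ i := fun h2 => hi (h1.symm.trans h2)
        simp [s, h2]
      · simp [s, h1]
  have hI : Integrable (fun B : Fin n → Fin N → ℂ =>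
      (((‖(Matrix.of fun i j => s i j - B i (e j)).det‖ ^ 2 : ℝ)) : ℂ)) μ := by
    simp_rw [hexp]
    exact integrable_finsetSum _ fun σ _ => integrable_finsetSum _ fun τ _ => hint σ τ
  have hre := hI.re
  simp only [RCLike.re_to_complex, Complex.ofReal_re] at hre
  refine ⟨hre, ?_⟩
  have hC : ∫ B : Fin n → Fin N → ℂ,
      (((‖(Matrix.of fun i j => s i j - B i (e j)).det‖ ^ 2 : ℝ)) : ℂ) ∂μ =
      ((∑ σ : Equiv.Perm (Fin n), ∏ i, ((if σ i = i then ‖z‖ ^ 2 else 0) + c⁻¹) : ℝ) : ℂ) := by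
    simp_rw [hexp]
    rw [integral_finsetSum _ fun σ _ => integrable_finsetSum _ fun τ _ => hint σ τ]
    simp_rw [integral_finsetSum _ fun τ _ => hint _ τ, hval]
    simp
  rw [integral_complex_ofReal] at hC
  exact_mod_cast hC

/-! ### The volume of the space of eigenvector directions. -/

theorem lintegral_exp_neg_mul_norm_sq {t : ℝ} (ht : 0 < t) :
    ∫⁻ z : ℂ, ENNReal.ofReal (Real.exp (-t * ‖z‖ ^ 2)) = ENNReal.ofReal (Real.pi / t) := by
  have h1 := integral_norm_sq_mul_exp ht 0
  have h2 := integrable_norm_sq_mul_exp ht 0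
  simp only [mul_zero, pow_zero, one_mul, Nat.factorial_zero, Nat.cast_one, mul_one, zero_add,
    pow_one] at h1 h2
  rw [← ofReal_integral_eq_lintegral_ofReal h2 (.of_forall fun z => (Real.exp_pos _).le), h1]

theorem lintegral_pow_mul_exp_neg_mul {W : ℝ} (hW : 0 < W) (n : ℕ) :
    ∫⁻ t in Set.Ioi (0 : ℝ), ENNReal.ofReal (t ^ n * Real.exp (-t * W)) =
      ENNReal.ofReal (n.factorial * W⁻¹ ^ (n + 1)) := by
  have h1 := Real.integral_rpow_mul_exp_neg_mul_Ioi (a := n + 1) (r := W) (by positivity) hW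
  have h3 : ∫ t in Set.Ioi (0 : ℝ), t ^ n * Real.exp (-t * W) =
      n.factorial * W⁻¹ ^ (n + 1) := by
    rw [Real.Gamma_nat_eq_factorial, one_div] at h1
    rw [mul_comm (n.factorial : ℝ), ← Real.rpow_natCast W⁻¹ (n + 1)]
    push_cast
    rw [← h1]
    refine setIntegral_congr_fun measurableSet_Ioi fun t _ => ?_
    simp only [add_sub_cancel_right, Real.rpow_natCast]
    ring_nf
  have h2 : IntegrableOn (fun t : ℝ => t ^ n * Real.exp (-t * W)) (Set.Ioi 0) := by
    by_contra h
    rw [integral_undef h] at h3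
    have : 0 < n.factorial * W⁻¹ ^ (n + 1) := by positivity
    linarith
  rw [← h3, ofReal_integral_eq_lintegral_ofReal h2]
  refine (ae_restrict_iff' measurableSet_Ioi).2 (.of_forall fun t ht => ?_)
  have : (0 : ℝ) < t := ht
  simp only [Pi.zero_apply]
  positivity

/-- The Fubini–Study volume of projective space, in an affine chart. -/
theorem lintegral_inv_one_add_norm_sq_pow (n : ℕ) :
    ∫⁻ y : Fin n → ℂ, ENNReal.ofReal ((1 + ∑ i, ‖y i‖ ^ 2)⁻¹ ^ (n + 1)) =
      ENNReal.ofReal (Real.pi ^ n / n.factorial) := by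
  have hf : (0 : ℝ) < n.factorial := by positivity
  -- Writing the power as a Gamma integral in t makes the y-integral Gaussian; its value (π/t)^n
  -- cancels the factor t^n.
  have h1 (y : Fin n → ℂ) : ENNReal.ofReal ((1 + ∑ i, ‖y i‖ ^ 2)⁻¹ ^ (n + 1)) =
      ENNReal.ofReal (n.factorial : ℝ)⁻¹ * ∫⁻ t in Set.Ioi (0 : ℝ),
        ENNReal.ofReal (t ^ n * Real.exp (-t * (1 + ∑ i, ‖y i‖ ^ 2))) := by
    rw [lintegral_pow_mul_exp_neg_mul (by positivity), ← ENNReal.ofReal_mul (by positivity),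
      ← mul_assoc, inv_mul_cancel₀ hf.ne', one_mul]
  simp_rw [h1]
  rw [lintegral_const_mul' _ _ ENNReal.ofReal_ne_top, lintegral_lintegral_swap (by fun_prop)]
  have h2 : ∀ t ∈ Set.Ioi (0 : ℝ), ∫⁻ y : Fin n → ℂ,
      ENNReal.ofReal (t ^ n * Real.exp (-t * (1 + ∑ i, ‖y i‖ ^ 2))) =
      ENNReal.ofReal (Real.pi ^ n) * ENNReal.ofReal (t ^ 0 * Real.exp (-t * 1)) := by
    intro t ht
    have ht' : (0 : ℝ) < t := ht
    have h3 (y : Fin n → ℂ) : ENNReal.ofReal (t ^ n * Real.exp (-t * (1 + ∑ i, ‖y i‖ ^ 2))) =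
        ENNReal.ofReal (t ^ n * Real.exp (-t)) *
          ∏ i, ENNReal.ofReal (Real.exp (-t * ‖y i‖ ^ 2)) := by
      rw [← ENNReal.ofReal_prod_of_nonneg fun i _ => (Real.exp_pos _).le,
        ← ENNReal.ofReal_mul (by positivity), ← Real.exp_sum, ← Finset.mul_sum, mul_assoc,
        ← Real.exp_add]
      ring_nf
    simp_rw [h3]
    have h4 : ∫⁻ y : Fin n → ℂ, ∏ i, ENNReal.ofReal (Real.exp (-t * ‖y i‖ ^ 2)) =
        ∏ _i : Fin n, ∫⁻ z : ℂ, ENNReal.ofReal (Real.exp (-t * ‖z‖ ^ 2)) :=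
      lintegral_pi_fin_prod volume (f := fun _ z => ENNReal.ofReal (Real.exp (-t * ‖z‖ ^ 2)))
        fun _ => by fun_prop
    rw [lintegral_const_mul' _ _ ENNReal.ofReal_ne_top, h4, lintegral_exp_neg_mul_norm_sq ht',
      Finset.prod_const, Finset.card_univ, Fintype.card_fin,
      ← ENNReal.ofReal_pow (by positivity), ← ENNReal.ofReal_mul (by positivity),
      ← ENNReal.ofReal_mul (by positivity)]
    congr 1
    rw [div_pow]
    field_simp
  rw [setLIntegral_congr_fun measurableSet_Ioi h2, lintegral_const_mul' _ _ ENNReal.ofReal_ne_top,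
    lintegral_pow_mul_exp_neg_mul one_pos 0, ← ENNReal.ofReal_mul (by positivity),
    ← ENNReal.ofReal_mul (by positivity)]
  congr 1
  simp
  ring

/-! ### The explicit density and its total mass. -/

/-- The one-point eigenvalue density of the complex Ginibre ensemble. -/
def ginibreDensity (N : ℕ) (z : ℂ) : ℝ :=
  Real.pi⁻¹ * (Real.exp (-N * ‖z‖ ^ 2) * ∑ k ∈ Finset.range N, (N * ‖z‖ ^ 2) ^ k / k.factorial)

theorem continuous_ginibreDensity (N : ℕ) : Continuous (ginibreDensity N) := by
  unfold ginibreDensity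
  fun_prop

theorem ginibreDensity_nonneg (N : ℕ) (z : ℂ) : 0 ≤ ginibreDensity N z := by
  unfold ginibreDensity
  have : 0 ≤ ∑ k ∈ Finset.range N, (N * ‖z‖ ^ 2) ^ k / (k.factorial : ℝ) :=
    Finset.sum_nonneg fun k _ => by positivity
  positivity

/-- Each of the N summands has mass 1/N. This normalisation is what later upgrades the Kac–Rice
inequality to an equality. -/
theorem lintegral_ginibreDensity {N : ℕ} (hN : 1 ≤ N) :
    ∫⁻ z, ENNReal.ofReal (ginibreDensity N z) = 1 := by
  have hc : (0 : ℝ) < N := by exact_mod_cast hN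
  have h (z : ℂ) : ginibreDensity N z = ∑ k ∈ Finset.range N,
      (Real.pi⁻¹ * N ^ k / k.factorial) * (‖z‖ ^ (2 * k) * Real.exp (-N * ‖z‖ ^ 2)) := by
    unfold ginibreDensity
    rw [Finset.mul_sum, Finset.mul_sum]
    refine Finset.sum_congr rfl fun k _ => ?_
    rw [mul_pow, ← pow_mul]
    ring
  have hi (k : ℕ) : Integrable fun z : ℂ =>
      (Real.pi⁻¹ * N ^ k / k.factorial) * (‖z‖ ^ (2 * k) * Real.exp (-N * ‖z‖ ^ 2)) :=
    (integrable_norm_sq_mul_exp hc k).const_mul _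
  have hI : Integrable (ginibreDensity N) := by
    rw [funext h]
    exact integrable_finsetSum _ fun k _ => hi k
  rw [← ofReal_integral_eq_lintegral_ofReal hI (.of_forall (ginibreDensity_nonneg N))]
  simp_rw [h]
  rw [integral_finsetSum _ fun k _ => hi k]
  have hk (k : ℕ) : ∫ z : ℂ,
      (Real.pi⁻¹ * N ^ k / k.factorial) * (‖z‖ ^ (2 * k) * Real.exp (-N * ‖z‖ ^ 2)) =
      (N : ℝ)⁻¹ := by
    rw [integral_const_mul, integral_norm_sq_mul_exp hc k]
    have : (k.factorial : ℝ) ≠ 0 := by positivity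
    rw [pow_succ]
    field_simp
  simp_rw [hk]
  simp [hc.ne']

/-! ### Asymptotics of Poisson probabilities at the edge. -/

theorem hasDerivAt_neg_exp_mul_sum (M : ℕ) (t : ℝ) :
    HasDerivAt (fun t : ℝ => -(Real.exp (-t) * ∑ k ∈ Finset.range (M + 1), t ^ k / k.factorial))
      (Real.exp (-t) * (t ^ M / M.factorial)) t := by
  have hs : HasDerivAt (fun t : ℝ => ∑ k ∈ Finset.range (M + 1), t ^ k / (k.factorial : ℝ))
      (∑ k ∈ Finset.range M, t ^ k / (k.factorial : ℝ)) t := by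
    induction M with
    | zero => simpa using hasDerivAt_const t (1 : ℝ)
    | succ M ih =>
      simp_rw [Finset.sum_range_succ _ (M + 1)]
      rw [Finset.sum_range_succ _ M]
      refine ih.add ?_
      have h := (hasDerivAt_pow (M + 1) t).div_const ((M + 1).factorial : ℝ)
      refine h.congr_deriv ?_
      rw [Nat.factorial_succ, Nat.add_sub_cancel]
      push_cast
      field_simp
  have he : HasDerivAt (fun t : ℝ => Real.exp (-t)) (-Real.exp (-t)) t := by
    simpa using (hasDerivAt_neg t).exp
  refine (he.mul hs).neg.congr_deriv ?_
  rw [Finset.sum_range_succ]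
  ring

/-- The tail integral representation of Poisson probabilities. -/
theorem exp_mul_sum_eq_integral (M : ℕ) {m a : ℝ} (h : 0 ≤ m + a) :
    Real.exp (-(m + a) ^ 2) * ∑ k ∈ Finset.range (M + 1), ((m + a) ^ 2) ^ k / k.factorial =
      ∫ s in Set.Ioi a,
        Real.exp (-(m + s) ^ 2) * (((m + s) ^ 2) ^ M / M.factorial) * (2 * (m + s)) := by
  have hd (s : ℝ) : HasDerivAt (fun s : ℝ => -(Real.exp (-(m + s) ^ 2) *
      ∑ k ∈ Finset.range (M + 1), ((m + s) ^ 2) ^ k / k.factorial))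
      (Real.exp (-(m + s) ^ 2) * (((m + s) ^ 2) ^ M / M.factorial) * (2 * (m + s))) s := by
    have h1 : HasDerivAt (fun s : ℝ => (m + s) ^ 2) (2 * (m + s)) s := by
      simpa using ((hasDerivAt_id s).const_add m).fun_pow 2
    exact HasDerivAt.comp (h₂ := fun t : ℝ => -(Real.exp (-t) *
      ∑ k ∈ Finset.range (M + 1), t ^ k / k.factorial)) (h := fun s : ℝ => (m + s) ^ 2) s
      (hasDerivAt_neg_exp_mul_sum M ((m + s) ^ 2)) h1
  have hlim : Tendsto (fun s : ℝ => -(Real.exp (-(m + s) ^ 2) *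
      ∑ k ∈ Finset.range (M + 1), ((m + s) ^ 2) ^ k / k.factorial)) atTop (𝓝 0) := by
    have h1 : Tendsto (fun t : ℝ => -(Real.exp (-t) *
        ∑ k ∈ Finset.range (M + 1), t ^ k / k.factorial)) atTop (𝓝 0) := by
      rw [← neg_zero]
      refine Tendsto.neg ?_
      simp_rw [Finset.mul_sum]
      rw [← Finset.sum_const_zero (s := Finset.range (M + 1))]
      refine tendsto_finsetSum _ fun k _ => ?_
      have := (Real.tendsto_pow_mul_exp_neg_atTop_nhds_zero k).div_const (k.factorial : ℝ)
      rw [zero_div] at this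
      refine this.congr fun t => ?_
      ring
    exact h1.comp ((tendsto_pow_atTop two_ne_zero).comp
      (tendsto_atTop_add_const_left _ m tendsto_id))
  rw [integral_Ioi_of_hasDerivAt_of_nonneg' (fun s _ => hd s) (fun s hs => ?_) hlim]
  · ring
  · have : a < s := hs
    have : 0 ≤ m + s := by linarith
    positivity

/-- With N = M + 1 and M! = N!/N, the weight is N^{N+1/2} e^{-N} / N!, to which Stirling's formula
applies. -/
theorem tendsto_stirling_weight :
    Tendsto (fun M : ℕ => Real.sqrt (M + 1 : ℕ) ^ (2 * M + 1) * Real.exp (-(M + 1 : ℕ)) /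
      M.factorial) atTop (𝓝 (1 / Real.sqrt (2 * Real.pi))) := by
  have h1 : Tendsto (fun M : ℕ => 1 / (Real.sqrt 2 * Stirling.stirlingSeq (M + 1))) atTop
      (𝓝 (1 / (Real.sqrt 2 * Real.sqrt Real.pi))) := by
    refine Tendsto.div tendsto_const_nhds ?_ (by positivity)
    exact (Stirling.tendsto_stirlingSeq_sqrt_pi.comp (tendsto_add_atTop_nat 1)).const_mul _
  rw [Real.sqrt_mul (by norm_num)]
  refine h1.congr fun M => ?_
  have hN : (0 : ℝ) < (M + 1 : ℕ) := by positivity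
  set r := Real.sqrt ((M + 1 : ℕ) : ℝ) with hr
  have hrpos : 0 < r := Real.sqrt_pos.2 hN
  have hr2 : r ^ 2 = ((M + 1 : ℕ) : ℝ) := Real.sq_sqrt hN.le
  rw [Stirling.stirlingSeq, Real.sqrt_mul (by norm_num), ← hr, div_pow, ← Real.exp_nat_mul,
    mul_one, Nat.factorial_succ, Nat.cast_mul, ← hr2, Real.exp_neg]
  have h2 : Real.sqrt 2 ≠ 0 := by positivity
  have h3 : (M.factorial : ℝ) ≠ 0 := by positivity
  have h4 := Real.exp_ne_zero (r ^ 2)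
  field_simp
  ring

/-- Second-order Taylor expansion of the logarithm; after multiplication by m² the cubic remainder
is O(1/m). -/
theorem tendsto_sq_mul_log_one_add_div (s : ℝ) :
    Tendsto (fun m : ℝ => m ^ 2 * Real.log (1 + s / m) - s * m) atTop (𝓝 (-s ^ 2 / 2)) := by
  have hx : Tendsto (fun m : ℝ => |s| ^ 3 / m / (1 - |s| / m)) atTop (𝓝 0) := by
    have h1 : Tendsto (fun m : ℝ => |s| ^ 3 / m) atTop (𝓝 0) :=
      tendsto_const_nhds.div_atTop tendsto_id
    have h2 : Tendsto (fun m : ℝ => 1 - |s| / m) atTop (𝓝 (1 - 0)) :=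
      tendsto_const_nhds.sub (tendsto_const_nhds.div_atTop tendsto_id)
    rw [show (0 : ℝ) = 0 / (1 - 0) by norm_num]
    exact h1.div h2 (by norm_num)
  rw [tendsto_iff_norm_sub_tendsto_zero]
  refine squeeze_zero' (.of_forall fun _ => norm_nonneg _) ?_ hx
  filter_upwards [eventually_gt_atTop |s|, eventually_gt_atTop 0] with m hm hm0
  have hlt : |(-(s / m))| < 1 := by
    rw [abs_neg, abs_div, abs_of_pos hm0, div_lt_one hm0]; exact hm
  have h := Real.abs_log_sub_add_sum_range_le hlt 2
  rw [Finset.sum_range_succ, Finset.sum_range_one, sub_neg_eq_add, abs_neg, abs_div,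
    abs_of_pos hm0] at h
  have hm2 : (0 : ℝ) < m ^ 2 := by positivity
  have he : m ^ 2 * Real.log (1 + s / m) - s * m - -s ^ 2 / 2 =
      m ^ 2 * ((-(s / m)) ^ (0 + 1) / ((0 : ℕ) + 1) + (-(s / m)) ^ (1 + 1) / ((1 : ℕ) + 1) +
        Real.log (1 + s / m)) := by
    push_cast
    field_simp
    ring
  rw [Real.norm_eq_abs, he, abs_mul, abs_of_pos hm2]
  refine (mul_le_mul_of_nonneg_left h hm2.le).trans (le_of_eq ?_)
  rw [← mul_div_assoc]
  rw [div_pow]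
  congr 1
  field_simp

/-- With m = √(M + 1) the exponent is 2M + 1 = 2m² - 1. The linear terms ±2sm cancel, and two
contributions -s² remain: one from the logarithm, one explicit. -/
theorem tendsto_pow_mul_exp_gaussian (s : ℝ) :
    Tendsto (fun M : ℕ => (1 + s / Real.sqrt (M + 1 : ℕ)) ^ (2 * M + 1) *
      Real.exp (-2 * s * Real.sqrt (M + 1 : ℕ) - s ^ 2)) atTop (𝓝 (Real.exp (-2 * s ^ 2))) := by
  have hm : Tendsto (fun M : ℕ => Real.sqrt (M + 1 : ℕ)) atTop atTop :=
    Real.tendsto_sqrt_atTop.comp (tendsto_natCast_atTop_atTop.comp (tendsto_add_atTop_nat 1))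
  have hx : Tendsto (fun M : ℕ => 1 + s / Real.sqrt (M + 1 : ℕ)) atTop (𝓝 1) := by
    simpa using (tendsto_const_nhds (x := (1 : ℝ))).add
      ((tendsto_const_nhds (x := s)).div_atTop hm)
  have hlog : Tendsto (fun M : ℕ => Real.log (1 + s / Real.sqrt (M + 1 : ℕ))) atTop (𝓝 0) := by
    simpa using hx.log one_ne_zero
  have h := ((((tendsto_sq_mul_log_one_add_div s).comp hm).const_mul 2).sub hlog).sub_const (s ^ 2)
  have h2 := (Real.continuous_exp.tendsto _).comp h
  rw [show 2 * (-s ^ 2 / 2) - 0 - s ^ 2 = -2 * s ^ 2 by ring] at h2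
  refine h2.congr' ?_
  filter_upwards [hx.eventually (lt_mem_nhds one_pos)] with M hM
  have hN : (0 : ℝ) ≤ (M + 1 : ℕ) := by positivity
  have h3 : (1 + s / Real.sqrt (M + 1 : ℕ)) ^ (2 * M + 1) =
      Real.exp ((2 * M + 1 : ℕ) * Real.log (1 + s / Real.sqrt (M + 1 : ℕ))) := by
    rw [Real.exp_nat_mul, Real.exp_log hM]
  rw [h3, ← Real.exp_add]
  simp only [Function.comp_apply, Real.sq_sqrt hN]
  congr 1
  push_cast
  ring

theorem integral_exp_neg_two_mul_sq (u : ℝ) :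
    ∫ s in Set.Ioi (-u), 2 * (1 / Real.sqrt (2 * Real.pi)) * Real.exp (-2 * s ^ 2) =
      stdNormalCDF (2 * u) := by
  have h1 := integral_comp_mul_left_Ioi (fun z : ℝ => Real.exp (-z ^ 2 / 2)) (-u)
    (two_pos : (0 : ℝ) < 2)
  have h2 := integral_comp_neg_Ioi (-(2 * u)) fun z : ℝ => Real.exp (-z ^ 2 / 2)
  simp only [neg_sq, neg_neg] at h2
  rw [mul_neg, h2, smul_eq_mul] at h1
  have h3 : ∀ s : ℝ, Real.exp (-2 * s ^ 2) = Real.exp (-(2 * s) ^ 2 / 2) := fun s => by ring_nf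
  simp_rw [h3]
  rw [stdNormalCDF, integral_const_mul, h1]
  ring

/-- The tail integral, centred at √(M + 1), has integrand 2 c_M ψ_M(s): a Stirling constant times a
profile tending to e^{-2s²}. Dominated convergence passes to the limit. -/
theorem tendsto_exp_mul_sum_poisson (u : ℝ) :
    Tendsto (fun M : ℕ => Real.exp (-(Real.sqrt (M + 1 : ℕ) + -u) ^ 2) *
      ∑ k ∈ Finset.range (M + 1), ((Real.sqrt (M + 1 : ℕ) + -u) ^ 2) ^ k / k.factorial) atTop
      (𝓝 (stdNormalCDF (2 * u))) := by
  have hm : Tendsto (fun M : ℕ => Real.sqrt (M + 1 : ℕ)) atTop atTop :=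
    Real.tendsto_sqrt_atTop.comp (tendsto_natCast_atTop_atTop.comp (tendsto_add_atTop_nat 1))
  let c : ℕ → ℝ := fun M => Real.sqrt (M + 1 : ℕ) ^ (2 * M + 1) * Real.exp (-(M + 1 : ℕ)) /
      M.factorial
  let ψ : ℕ → ℝ → ℝ := fun M s => (1 + s / Real.sqrt (M + 1 : ℕ)) ^ (2 * M + 1) *
      Real.exp (-2 * s * Real.sqrt (M + 1 : ℕ) - s ^ 2)
  have hc0 (M : ℕ) : 0 ≤ c M := by positivity
  have hform (M : ℕ) (s : ℝ) : Real.exp (-(Real.sqrt (M + 1 : ℕ) + s) ^ 2) *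
      (((Real.sqrt (M + 1 : ℕ) + s) ^ 2) ^ M / M.factorial) * (2 * (Real.sqrt (M + 1 : ℕ) + s)) =
      2 * c M * ψ M s := by
    have hN : (0 : ℝ) < (M + 1 : ℕ) := by positivity
    simp only [c, ψ]
    set r := Real.sqrt ((M + 1 : ℕ) : ℝ) with hr
    have hrpos : 0 < r := Real.sqrt_pos.2 hN
    have hr2 : ((M + 1 : ℕ) : ℝ) = r ^ 2 := (Real.sq_sqrt hN.le).symm
    have h1 : (1 + s / r) = (r + s) / r := by field_simp
    have h2 : Real.exp (-(r + s) ^ 2) =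
        Real.exp (-r ^ 2) * Real.exp (-2 * s * r - s ^ 2) := by
      rw [← Real.exp_add]; ring_nf
    rw [h1, h2, hr2, div_pow, ← pow_mul, pow_succ (r + s), pow_succ r]
    field_simp
  obtain ⟨K, hK⟩ : ∃ K, ∀ M, c M ≤ K := by
    obtain ⟨K, hK⟩ := tendsto_stirling_weight.bddAbove_range
    exact ⟨K, fun M => hK ⟨M, rfl⟩⟩
  have hK0 : 0 ≤ K := (hc0 0).trans (hK 0)
  -- By 1 + x ≤ e^x the exponent is at most (2r² - 1)s/r - 2sr - s² = -s/r - s² with r = √(M + 1),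
  -- and r ≥ 1 bounds -s/r by |s|.
  have hψ (M : ℕ) {s : ℝ} (hs : 0 ≤ Real.sqrt (M + 1 : ℕ) + s) :
      0 ≤ ψ M s ∧ ψ M s ≤ Real.exp (|s| - s ^ 2) := by
    have hN : (1 : ℝ) ≤ (M + 1 : ℕ) := by exact_mod_cast Nat.le_add_left 1 M
    have hr2 := Real.sq_sqrt (zero_le_one.trans hN)
    have hr1 : 1 ≤ Real.sqrt (M + 1 : ℕ) := Real.one_le_sqrt.2 hN
    simp only [ψ]
    set r := Real.sqrt ((M + 1 : ℕ) : ℝ) with hr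
    have hrpos : 0 < r := one_pos.trans_le hr1
    have h1 : (1 + s / r) = (r + s) / r := by field_simp
    have h0 : 0 ≤ 1 + s / r := by rw [h1]; positivity
    refine ⟨by positivity, ?_⟩
    have hle : (1 + s / r) ^ (2 * M + 1) ≤ Real.exp ((2 * M + 1 : ℕ) * (s / r)) := by
      rw [Real.exp_nat_mul]
      exact pow_le_pow_left₀ h0 (by linarith [Real.add_one_le_exp (s / r)]) _
    refine (mul_le_mul_of_nonneg_right hle (Real.exp_pos _).le).trans ?_
    rw [← Real.exp_add, Real.exp_le_exp]
    have h2 : ((2 * M + 1 : ℕ) : ℝ) = 2 * r ^ 2 - 1 := by rw [hr2]; push_cast; ring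
    have h3 : ((2 * M + 1 : ℕ) : ℝ) * (s / r) = 2 * s * r - s / r := by
      rw [h2]; field_simp
    have h4 : -(s / r) ≤ |s| := by
      rw [← neg_div, div_le_iff₀ hrpos]
      nlinarith [neg_abs_le s, abs_nonneg s]
    rw [h3]
    linarith
  -- From here on √(M + 1) + s ≥ 0 on the whole range s > -u, as both the tail formula and the
  -- domination require.
  have hev : ∀ᶠ M : ℕ in atTop, u ≤ Real.sqrt (M + 1 : ℕ) := hm.eventually_ge_atTop u
  have hint : Integrable fun s : ℝ => 2 * K * Real.exp (|s| - s ^ 2) := by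
    refine Integrable.const_mul ?_ _
    have hg : Integrable fun s : ℝ => Real.exp 1 * Real.exp (-(1 / 2) * s ^ 2) :=
      (integrable_exp_neg_mul_sq (by norm_num)).const_mul _
    refine hg.mono' (by fun_prop) (.of_forall fun s => ?_)
    rw [Real.norm_of_nonneg (Real.exp_pos _).le, ← Real.exp_add, Real.exp_le_exp]
    nlinarith [sq_nonneg (|s| - 1), sq_abs s]
  rw [← integral_exp_neg_two_mul_sq]
  have hdom : Tendsto (fun M : ℕ => ∫ s in Set.Ioi (-u), 2 * c M * ψ M s) atTop
      (𝓝 (∫ s in Set.Ioi (-u), 2 * (1 / Real.sqrt (2 * Real.pi)) * Real.exp (-2 * s ^ 2))) := by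
    refine tendsto_integral_filter_of_dominated_convergence
      (fun s : ℝ => 2 * K * Real.exp (|s| - s ^ 2)) ?_ ?_ hint.integrableOn ?_
    · refine .of_forall fun M => Continuous.aestronglyMeasurable ?_
      simp only [ψ]
      fun_prop
    · filter_upwards [hev] with M hM
      refine (ae_restrict_iff' measurableSet_Ioi).2 (.of_forall fun s hs => ?_)
      have hs' : -u < s := hs
      obtain ⟨h1, h2⟩ := hψ M (s := s) (by linarith)
      have := hc0 M
      rw [Real.norm_of_nonneg (by positivity)]
      have := hK M
      gcongr
    · exact .of_forall fun s =>
        (tendsto_stirling_weight.const_mul 2).mul (tendsto_pow_mul_exp_gaussian s)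
  refine hdom.congr' ?_
  filter_upwards [hev] with M hM
  rw [exp_mul_sum_eq_integral M (by linarith)]
  simp_rw [hform]

/-! ### The Kac–Rice lower bound. -/

/-- The derivative is a pointwise limit of difference quotients of t ↦ det(t - A), each continuous
in A. -/
theorem measurable_eval_derivative_charpoly (N : ℕ) (z : ℂ) :
    Measurable fun A : Fin N → Fin N → ℂ => (Matrix.of A).charpoly.derivative.eval z := by
  have hu : Tendsto (fun k : ℕ => z + 1 / ((k : ℂ) + 1)) atTop (𝓝[≠] z) := by
    refine tendsto_nhdsWithin_iff.2 ⟨?_, .of_forall fun k => ?_⟩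
    · simpa using tendsto_one_div_add_atTop_nhds_zero_nat (𝕜 := ℂ) |>.const_add z
    · have : (k : ℂ) + 1 ≠ 0 := Nat.cast_add_one_ne_zero k
      simp [this]
  refine measurable_of_tendsto_metrizable (f := fun (k : ℕ) (A : Fin N → Fin N → ℂ) =>
    slope (fun t => (Matrix.of A).charpoly.eval t) z (z + 1 / ((k : ℂ) + 1))) (fun k => ?_) ?_
  · simp only [slope_def_field, Matrix.eval_charpoly]
    have h (t : ℂ) : Continuous fun A : Fin N → Fin N → ℂ =>
        (Matrix.scalar (Fin N) t - Matrix.of A).det :=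
      Continuous.matrix_det (continuous_const.sub continuous_id)
    exact ((h _).measurable.sub (h z).measurable).div_const _
  · rw [tendsto_pi_nhds]
    intro A
    exact ((Matrix.of A).charpoly.hasDerivAt z).tendsto_slope.comp hu

/-- The weight of an eigenvalue `z` in the Kac–Rice formula for the Ginibre ensemble. -/
def eigenvalueWeight (c : ℝ) {N : ℕ} (z : ℂ) (A : Matrix (Fin N) (Fin N) ℂ) : ENNReal :=
  ENNReal.ofReal (matrixGaussianPDF c A * ‖A.charpoly.derivative.eval z‖ ^ 2)

theorem matrixGaussianPDF_eq (c : ℝ) {m n : ℕ} (A : Fin m → Fin n → ℂ) :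
    matrixGaussianPDF c A =
      (c / Real.pi) ^ (m * n) * Real.exp (-c * ∑ i, ∑ j, ‖A i j‖ ^ 2) := by
  simp only [matrixGaussianPDF, complexGaussianPDF, Finset.prod_mul_distrib, Finset.prod_const,
    Finset.card_univ, Fintype.card_fin, ← Real.exp_sum, ← pow_mul, Finset.mul_sum]
  rw [mul_comm n m]

theorem sum_norm_sq_eq_re_trace {N : ℕ} (A : Matrix (Fin N) (Fin N) ℂ) :
    ∑ i, ∑ j, ‖A i j‖ ^ 2 = (A * star A).trace.re := by
  simp only [Matrix.trace, Matrix.diag_apply, Matrix.mul_apply, Matrix.star_apply, Complex.re_sum]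
  refine Finset.sum_congr rfl fun i _ => Finset.sum_congr rfl fun j _ => ?_
  rw [Complex.star_def, Complex.mul_conj, Complex.ofReal_re, Complex.normSq_eq_norm_sq]

/-- The Gaussian density depends on A only through tr(AA*), and the characteristic polynomial is
invariant under conjugation. -/
theorem eigenvalueWeight_unitary_conj (c : ℝ) {N : ℕ} (z : ℂ) {Q : Matrix (Fin N) (Fin N) ℂ}
    (hQ : Q ∈ Matrix.unitaryGroup (Fin N) ℂ) (A : Matrix (Fin N) (Fin N) ℂ) :
    eigenvalueWeight c z (star Q * A * Q) = eigenvalueWeight c z A := by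
  have h1 : Q * star Q = 1 := Matrix.mem_unitaryGroup_iff.1 hQ
  have hchar : (star Q * A * Q).charpoly = A.charpoly := by
    rw [Matrix.charpoly_mul_comm, ← mul_assoc, h1, one_mul]
  have htr : (star Q * A * Q * star (star Q * A * Q)).trace = (A * star A).trace := by
    rw [star_mul, star_mul, star_star]
    calc (star Q * A * Q * (star Q * (star A * Q))).trace
        = (star Q * (A * (Q * star Q) * star A * Q)).trace := by simp only [mul_assoc]
      _ = (A * (Q * star Q) * star A * Q * star Q).trace := Matrix.trace_mul_comm _ _
      _ = (A * star A).trace := by rw [h1, mul_one, mul_assoc, h1, mul_one]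
  have hpdf : matrixGaussianPDF c (star Q * A * Q) = matrixGaussianPDF c A := by
    refine (matrixGaussianPDF_eq c _).trans (Eq.trans ?_ (matrixGaussianPDF_eq c A).symm)
    rw [sum_norm_sq_eq_re_trace (star Q * A * Q), sum_norm_sq_eq_re_trace A, htr]
  simp only [eigenvalueWeight, hchar, hpdf]

theorem measurable_eigenvalueWeight (c : ℝ) (N : ℕ) (z : ℂ) :
    Measurable fun A : Fin N → Fin N → ℂ => eigenvalueWeight c z (Matrix.of A) :=
  ((continuous_matrixGaussianPDF c N N).measurable.mul
    ((measurable_eval_derivative_charpoly N z).norm.pow_const 2)).ennreal_ofReal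

theorem matrixGaussianPDF_consMatrix_single (c : ℝ) {n : ℕ} (z : ℂ)
    (B : Fin n → Fin (n + 1) → ℂ) :
    matrixGaussianPDF c (consMatrix (Pi.single 0 z) B) =
      (c / Real.pi) ^ (n + 1) * Real.exp (-c * ‖z‖ ^ 2) * matrixGaussianPDF c B := by
  unfold matrixGaussianPDF
  rw [Fin.prod_univ_succ]
  simp only [consMatrix_zero, consMatrix_succ]
  congr 1
  rw [Fin.prod_univ_succ]
  simp [complexGaussianPDF]
  ring

theorem det_reducedMatrix_single {n : ℕ} (z : ℂ) (r : Fin (n + 1) → ℂ)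
    (B : Fin n → Fin (n + 1) → ℂ) :
    (reducedMatrix z (consMatrix r B) (Pi.single 0 1)).det =
      (Matrix.of fun i j : Fin n => (if i = j then z else 0) - B i j.succ).det := by
  rw [Matrix.det_succ_row_zero, Finset.sum_eq_single 0]
  · simp only [reducedMatrix, Matrix.updateRow_self, Fin.val_zero, pow_zero, Pi.single_eq_same,
      one_mul]
    congr 1
    ext i j
    simp [Matrix.diagonal_apply, consMatrix_succ]
  · intro j _ hj
    simp [reducedMatrix, hj]
  · simp

/-- For the left eigenvector e₀, χ'(z) is the determinant of z minus the lower right n × n block.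
The zeroth row gives a constant, and the other rows give a Gaussian second moment. -/
theorem lintegral_eigenvalueWeight_single {c : ℝ} (hc : 0 < c) (n : ℕ) (z : ℂ) :
    ∫⁻ B : Fin n → Fin (n + 1) → ℂ, eigenvalueWeight c z (consMatrix (Pi.single 0 z) B) =
      ENNReal.ofReal ((c / Real.pi) ^ (n + 1) * Real.exp (-c * ‖z‖ ^ 2) *
        ∑ k ∈ Finset.range (n + 1),
          (n.choose k) * ((‖z‖ ^ 2) ^ k * c⁻¹ ^ (n - k) * (n - k).factorial)) := by
  obtain ⟨hi, hv⟩ := integral_norm_det_sq hc (Fin.succ : Fin n → Fin (n + 1))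
    (Fin.succ_injective n) z
  rw [sum_perm_prod_add] at hv
  have h1 (B : Fin n → Fin (n + 1) → ℂ) : eigenvalueWeight c z (consMatrix (Pi.single 0 z) B) =
      ENNReal.ofReal ((c / Real.pi) ^ (n + 1) * Real.exp (-c * ‖z‖ ^ 2)) *
        (ENNReal.ofReal (matrixGaussianPDF c B) * ENNReal.ofReal
          (‖(Matrix.of fun i j : Fin n => (if i = j then z else 0) - B i j.succ).det‖ ^ 2)) := by
    have heig : Matrix.vecMul (Pi.single 0 1) (consMatrix (Pi.single 0 z) B) =
        z • (Pi.single 0 1 : Fin (n + 1) → ℂ) := by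
      funext j
      rw [Matrix.single_one_vecMul]
      simp [consMatrix_zero, Pi.single_apply]
    unfold eigenvalueWeight
    rw [eval_derivative_charpoly_of_vecMul_eq (Pi.single_eq_same _ _) heig,
      det_reducedMatrix_single, matrixGaussianPDF_consMatrix_single,
      ← ENNReal.ofReal_mul (matrixGaussianPDF_nonneg hc B),
      ← ENNReal.ofReal_mul (by positivity), mul_assoc]
  have hm : Measurable fun B : Fin n → Fin (n + 1) → ℂ =>
      ‖(Matrix.of fun i j : Fin n => (if i = j then z else 0) - B i j.succ).det‖ ^ 2 := by
    refine (Continuous.pow (Continuous.norm (Continuous.matrix_det ?_)) 2).measurable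
    exact continuous_pi fun i => continuous_pi fun j => by
      simp only [Matrix.of_apply]; fun_prop
  simp_rw [h1]
  rw [lintegral_const_mul' _ _ ENNReal.ofReal_ne_top]
  have h2 := lintegral_withDensity_eq_lintegral_mul
    (volume : Measure (Fin n → Fin (n + 1) → ℂ))
    (continuous_matrixGaussianPDF c n (n + 1)).measurable.ennreal_ofReal hm.ennreal_ofReal
  simp only [Pi.mul_apply] at h2
  rw [← h2, ← pi_complexGaussian hc, ← ofReal_integral_eq_lintegral_ofReal hi
    (.of_forall fun B => by positivity), hv, ← ENNReal.ofReal_mul (by positivity)]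

theorem continuous_affineVec (n : ℕ) :
    Continuous (affineVec : (Fin (n + 1) → ℂ) → Fin (n + 1) → ℂ) := by
  refine continuous_pi fun j => ?_
  refine Fin.cases ?_ (fun k => ?_) j
  · simp only [affineVec_zero]; fun_prop
  · simp only [affineVec_succ]; fun_prop

theorem continuous_eigenChart (n : ℕ) :
    Continuous fun q : (Fin n → Fin (n + 1) → ℂ) × (Fin (n + 1) → ℂ) => eigenChart q.1 q.2 := by
  have := continuous_affineVec n
  unfold eigenChart
  fun_prop

theorem continuous_consMatrix (n : ℕ) :
    Continuous fun q : (Fin (n + 1) → ℂ) × (Fin n → Fin (n + 1) → ℂ) => consMatrix q.1 q.2 := by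
  refine continuous_pi fun i => continuous_pi fun j => ?_
  refine Fin.cases ?_ (fun k => ?_) i
  · simp only [consMatrix_zero]; fun_prop
  · simp only [consMatrix_succ]; fun_prop

theorem continuous_det_eigenChartDeriv (n : ℕ) :
    Continuous fun q : (Fin n → Fin (n + 1) → ℂ) × (Fin (n + 1) → ℂ) =>
      (eigenChartDeriv q.1 q.2).det := by
  simp only [det_eigenChartDeriv]
  refine Continuous.pow (Continuous.norm (Continuous.matrix_det ?_)) 2
  refine continuous_pi fun i => continuous_pi fun j => ?_
  refine Fin.cases ?_ (fun k => ?_) i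
  · simp only [reducedMatrix, Matrix.updateRow_self]
    exact (continuous_apply j).comp ((continuous_affineVec n).comp continuous_snd)
  · simp only [reducedMatrix, Matrix.updateRow_ne (Fin.succ_ne_zero k), Matrix.sub_apply,
      Matrix.scalar_apply, Matrix.diagonal_apply, consMatrix_succ]
    split_ifs <;> fun_prop

/-- The density of the eigenvalue intensity as it comes out of the Kac–Rice formula. -/
theorem kacRice_density_eq (n : ℕ) (z : ℂ) :
    Real.pi ^ n / n.factorial * (((n + 1 : ℕ) / Real.pi) ^ (n + 1) *
      Real.exp (-(n + 1 : ℕ) * ‖z‖ ^ 2) * ∑ k ∈ Finset.range (n + 1), (n.choose k) *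
        ((‖z‖ ^ 2) ^ k * ((n + 1 : ℕ) : ℝ)⁻¹ ^ (n - k) * (n - k).factorial)) =
      (n + 1 : ℕ) * ginibreDensity (n + 1) z := by
  unfold ginibreDensity
  set c : ℝ := ((n + 1 : ℕ) : ℝ) with hc
  have hcpos : 0 < c := by positivity
  have hk : ∀ k ∈ Finset.range (n + 1), (n.choose k : ℝ) *
      ((‖z‖ ^ 2) ^ k * c⁻¹ ^ (n - k) * (n - k).factorial) =
      n.factorial / c ^ n * ((c * ‖z‖ ^ 2) ^ k / k.factorial) := by
    intro k hk
    have hkn : k ≤ n := Nat.lt_succ_iff.1 (Finset.mem_range.1 hk)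
    have h1 : (n.choose k : ℝ) * k.factorial * (n - k).factorial = n.factorial := by
      exact_mod_cast Nat.choose_mul_factorial_mul_factorial hkn
    have h2 : c ^ n = c ^ k * c ^ (n - k) := by rw [← pow_add, Nat.add_sub_cancel' hkn]
    have h3 : (k.factorial : ℝ) ≠ 0 := by positivity
    rw [← h1, h2, inv_pow, mul_pow]
    field_simp
  rw [Finset.sum_congr rfl hk, ← Finset.mul_sum, div_pow, pow_succ, pow_succ]
  have h3 : (n.factorial : ℝ) ≠ 0 := by positivity
  field_simp

theorem measurable_eigenvalueSum {N : ℕ} {f : ℂ → ℝ} (hf : Continuous f) :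
    Measurable fun A : Fin N → Fin N → ℂ => eigenvalueSum (Matrix.of A) f := by
  have h : Continuous fun A : Fin N → Fin N → ℂ => eigenvalueSum (Matrix.of A) f :=
    continuous_eigenvalueSum hf
  exact h.measurable

theorem eigenvalueSum_nonneg {N : ℕ} (A : Matrix (Fin N) (Fin N) ℂ) {f : ℂ → ℝ}
    (hf : ∀ z, 0 ≤ f z) : 0 ≤ eigenvalueSum A f := by
  obtain ⟨v, hv⟩ := exists_map_univ_eq_roots_charpoly A
  rw [eigenvalueSum_eq_sum hv]
  exact Finset.sum_nonneg fun i _ => hf _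

theorem sum_map_ofReal_roots {N : ℕ} (A : Matrix (Fin N) (Fin N) ℂ) {f : ℂ → ℝ}
    (hf : ∀ z, 0 ≤ f z) :
    (A.charpoly.roots.map fun z => ENNReal.ofReal (f z)).sum =
      ENNReal.ofReal (eigenvalueSum A f) := by
  obtain ⟨v, hv⟩ := exists_map_univ_eq_roots_charpoly A
  rw [eigenvalueSum_eq_sum hv, ENNReal.ofReal_sum_of_nonneg fun i _ => hf _, ← hv,
    Multiset.map_map]
  rfl

/-- The Kac–Rice lower bound for the intensity of the eigenvalues, with respect to the Lebesgue
density of the Ginibre matrix. -/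
theorem lintegral_ginibreDensity_le (n : ℕ) {f : ℂ → ℝ} (hf : Continuous f) (h0 : ∀ z, 0 ≤ f z) :
    ∫⁻ z, ENNReal.ofReal (f z * ((n + 1 : ℕ) * ginibreDensity (n + 1) z)) ≤
      ∫⁻ A : Fin (n + 1) → Fin (n + 1) → ℂ,
        ENNReal.ofReal (matrixGaussianPDF (n + 1 : ℕ) A) *
          ENNReal.ofReal (eigenvalueSum (Matrix.of A) f) := by
  set c : ℝ := ((n + 1 : ℕ) : ℝ) with hc
  have hcpos : 0 < c := by positivity
  have hmeas : Measurable fun A : Fin (n + 1) → Fin (n + 1) → ℂ =>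
      ENNReal.ofReal (matrixGaussianPDF c A) *
          ENNReal.ofReal (eigenvalueSum (Matrix.of A) f) :=
    (continuous_matrixGaussianPDF c _ _).measurable.ennreal_ofReal.mul
      (measurable_eigenvalueSum hf).ennreal_ofReal
  let h : (Fin n → Fin (n + 1) → ℂ) → (Fin (n + 1) → ℂ) → ENNReal := fun B p =>
    ENNReal.ofReal (f (p 0)) * ENNReal.ofReal (matrixGaussianPDF c (consMatrix (eigenChart B p) B))
  -- With B fixed, the area inequality is applied to the zeroth row as a function of eigenvalue and
  -- eigenvector.
  have harea (B : Fin n → Fin (n + 1) → ℂ) :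
      ∫⁻ p, ENNReal.ofReal |(eigenChartDeriv B p).det| * h B p ≤
        ∫⁻ r : Fin (n + 1) → ℂ, ENNReal.ofReal (matrixGaussianPDF c (consMatrix r B)) *
          ENNReal.ofReal (eigenvalueSum (consMatrix r B) f) := by
    refine lintegral_mul_abs_det_le volume (hasFDerivAt_eigenChart B)
      ((continuous_det_eigenChartDeriv n).comp
        (continuous_const.prodMk continuous_id)).measurable fun r T hT => ?_
    have h1 : ∀ p ∈ T, h B p = ENNReal.ofReal (f (p 0)) *
        ENNReal.ofReal (matrixGaussianPDF c (consMatrix r B)) := fun p hp => by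
      simp only [h, (hT p hp).1]
    rw [Finset.sum_congr rfl h1, ← Finset.sum_mul, mul_comm, ← sum_map_ofReal_roots _ h0]
    exact mul_le_mul_right (sum_le_sum_roots_of_eigenChart B r _ T hT) _
  have hswap : Measurable (Function.uncurry fun (B : Fin n → Fin (n + 1) → ℂ)
      (p : Fin (n + 1) → ℂ) => ENNReal.ofReal |(eigenChartDeriv B p).det| * h B p) := by
    change Measurable fun q : (Fin n → Fin (n + 1) → ℂ) × (Fin (n + 1) → ℂ) =>
      ENNReal.ofReal |(eigenChartDeriv q.1 q.2).det| * (ENNReal.ofReal (f (q.2 0)) *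
        ENNReal.ofReal (matrixGaussianPDF c (consMatrix (eigenChart q.1 q.2) q.1)))
    have h1 : Continuous fun q : (Fin n → Fin (n + 1) → ℂ) × (Fin (n + 1) → ℂ) => f (q.2 0) :=
      hf.comp ((continuous_apply 0).comp continuous_snd)
    have h2 : Continuous fun q : (Fin n → Fin (n + 1) → ℂ) × (Fin (n + 1) → ℂ) =>
        matrixGaussianPDF c (consMatrix (eigenChart q.1 q.2) q.1) :=
      (continuous_matrixGaussianPDF c _ _).comp
        ((continuous_consMatrix n).comp ((continuous_eigenChart n).prodMk continuous_fst))
    exact (continuous_det_eigenChartDeriv n).abs.measurable.ennreal_ofReal.mul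
      (h1.measurable.ennreal_ofReal.mul h2.measurable.ennreal_ofReal)
  -- The Jacobian is |χ'(p₀)|², so the integrand is f(p₀) times a unitarily invariant weight and the
  -- eigenvector can be rotated to e₀.
  have hinner (p : Fin (n + 1) → ℂ) :
      ∫⁻ B, ENNReal.ofReal |(eigenChartDeriv B p).det| * h B p =
        ENNReal.ofReal (f (p 0)) * (ENNReal.ofReal ((∑ j, ‖affineVec p j‖ ^ 2)⁻¹ ^ (n + 1)) *
          ∫⁻ B : Fin n → Fin (n + 1) → ℂ,
            eigenvalueWeight c (p 0) (consMatrix (Pi.single 0 (p 0)) B)) := by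
    rw [← lintegral_consMatrix_eigenChart (measurable_eigenvalueWeight c (n + 1) (p 0))
      (fun Q hQ A => eigenvalueWeight_unitary_conj c (p 0) hQ A),
      ← lintegral_const_mul' _ _ ENNReal.ofReal_ne_top]
    refine lintegral_congr fun B => ?_
    simp only [h, eigenvalueWeight]
    rw [eval_derivative_charpoly_of_vecMul_eq (affineVec_zero p) (vecMul_consMatrix_eq_iff.2 rfl),
      det_eigenChartDeriv, reducedMatrix_consMatrix _ 0 (eigenChart B p),
      abs_of_nonneg (sq_nonneg _), ENNReal.ofReal_mul' (sq_nonneg _)]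
    ring
  let D : ℂ → ℝ := fun z => (c / Real.pi) ^ (n + 1) * Real.exp (-c * ‖z‖ ^ 2) *
        ∑ k ∈ Finset.range (n + 1),
          (n.choose k) * ((‖z‖ ^ 2) ^ k * c⁻¹ ^ (n - k) * (n - k).factorial)
  have hD : Continuous D := by fun_prop
  have hD0 (z : ℂ) : 0 ≤ D z := by
    have : 0 ≤ ∑ k ∈ Finset.range (n + 1),
          (n.choose k : ℝ) * ((‖z‖ ^ 2) ^ k * c⁻¹ ^ (n - k) * (n - k).factorial) :=
      Finset.sum_nonneg fun k _ => by positivity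
    simp only [D]
    positivity
  have hfib (z : ℂ) (y : Fin n → ℂ) : ∑ j, ‖affineVec (Fin.cons z y : Fin (n + 1) → ℂ) j‖ ^ 2 =
      1 + ∑ i, ‖y i‖ ^ 2 := by
    rw [Fin.sum_univ_succ]
    simp [affineVec_zero, affineVec_succ]
  -- Splitting p into eigenvalue z and direction y separates the integrals: y enters only through (1
  -- + |y|²)^{-(n+1)}.
  have hmain : ∫⁻ p : Fin (n + 1) → ℂ, ∫⁻ B : Fin n → Fin (n + 1) → ℂ,
      ENNReal.ofReal |(eigenChartDeriv B p).det| * h B p =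
      ∫⁻ z, ENNReal.ofReal (f z * ((n + 1 : ℕ) * ginibreDensity (n + 1) z)) := by
    simp_rw [hinner, lintegral_eigenvalueWeight_single hcpos]
    have hmp : Measurable fun p : Fin (n + 1) → ℂ => ENNReal.ofReal (f (p 0)) *
        (ENNReal.ofReal ((∑ j, ‖affineVec p j‖ ^ 2)⁻¹ ^ (n + 1)) * ENNReal.ofReal (D (p 0))) := by
      have h1 := continuous_affineVec n
      have h2 : Measurable fun p : Fin (n + 1) → ℂ => ∑ j, ‖affineVec p j‖ ^ 2 :=
        Continuous.measurable (by fun_prop)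
      exact (hf.comp (continuous_apply 0)).measurable.ennreal_ofReal.mul
        ((h2.inv.pow_const _).ennreal_ofReal.mul
          (hD.comp (continuous_apply 0)).measurable.ennreal_ofReal)
    refine (lintegral_pi_fin_succ (volume : Measure ℂ) hmp).trans (lintegral_congr fun z => ?_)
    simp only [Fin.cons_zero, hfib]
    rw [lintegral_const_mul' _ _ ENNReal.ofReal_ne_top,
      lintegral_mul_const' _ _ ENNReal.ofReal_ne_top]
    refine (congrArg (fun t => ENNReal.ofReal (f z) * (t * ENNReal.ofReal (D z)))
      (lintegral_inv_one_add_norm_sq_pow n)).trans ?_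
    rw [← kacRice_density_eq, ENNReal.ofReal_mul (h0 z),
      ENNReal.ofReal_mul (p := Real.pi ^ n / n.factorial) (by positivity)]
  calc ∫⁻ z, ENNReal.ofReal (f z * ((n + 1 : ℕ) * ginibreDensity (n + 1) z))
      = ∫⁻ B : Fin n → Fin (n + 1) → ℂ, ∫⁻ p : Fin (n + 1) → ℂ,
          ENNReal.ofReal |(eigenChartDeriv B p).det| * h B p := by
        rw [← hmain, lintegral_lintegral_swap hswap.aemeasurable]
    _ ≤ ∫⁻ B : Fin n → Fin (n + 1) → ℂ, ∫⁻ r : Fin (n + 1) → ℂ,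
          ENNReal.ofReal (matrixGaussianPDF c (consMatrix r B)) *
            ENNReal.ofReal (eigenvalueSum (consMatrix r B) f) := lintegral_mono harea
    _ = _ := (lintegral_pi_fin_succ_symm (volume : Measure (Fin (n + 1) → ℂ)) hmeas).symm

/-! ### From the lower bound to the one-point density. -/

instance ginibreNoise_isProbabilityMeasure (N : ℕ) : IsProbabilityMeasure (ginibreNoise N) := by
  unfold ginibreNoise
  infer_instance

theorem measurable_ginibreMatrix (N : ℕ) :
    Measurable fun (ω : Fin N → Fin N → ℝ × ℝ) (j k : Fin N) => ginibreMatrix N ω j k := by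
  simp only [ginibreMatrix, Matrix.of_apply]
  fun_prop

theorem measurable_eigenvalueSum_ginibreMatrix (N : ℕ) {f : ℂ → ℝ} (hf : Continuous f) :
    Measurable fun ω => eigenvalueSum (ginibreMatrix N ω) f :=
  (measurable_eigenvalueSum hf).comp (measurable_ginibreMatrix N)

theorem abs_eigenvalueSum_le {N : ℕ} (A : Matrix (Fin N) (Fin N) ℂ) {f : ℂ → ℝ} {M : ℝ}
    (hM : ∀ z, |f z| ≤ M) : |eigenvalueSum A f| ≤ N * M := by
  obtain ⟨v, hv⟩ := exists_map_univ_eq_roots_charpoly A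
  rw [eigenvalueSum_eq_sum hv]
  refine (Finset.abs_sum_le_sum_abs _ _).trans ((Finset.sum_le_sum fun i _ => hM (v i)).trans ?_)
  simp

theorem integrable_eigenvalueSum_ginibreMatrix (N : ℕ) {f : ℂ → ℝ} (hf : Continuous f) {M : ℝ}
    (hM : ∀ z, |f z| ≤ M) :
    Integrable (fun ω => eigenvalueSum (ginibreMatrix N ω) f) (ginibreNoise N) :=
  .of_bound (measurable_eigenvalueSum_ginibreMatrix N hf).aestronglyMeasurable (N * M)
    (.of_forall fun _ => abs_eigenvalueSum_le _ hM)

theorem lintegral_eigenvalueSum_ginibreMatrix {N : ℕ} (hN : 1 ≤ N) {f : ℂ → ℝ}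
    (hf : Continuous f) :
    ∫⁻ ω, ENNReal.ofReal (eigenvalueSum (ginibreMatrix N ω) f) ∂(ginibreNoise N) =
      ∫⁻ A : Fin N → Fin N → ℂ, ENNReal.ofReal (matrixGaussianPDF N A) *
          ENNReal.ofReal (eigenvalueSum (Matrix.of A) f) := by
  have hm : Measurable fun A : Fin N → Fin N → ℂ =>
      ENNReal.ofReal (eigenvalueSum (Matrix.of A) f) :=
    (measurable_eigenvalueSum hf).ennreal_ofReal
  have h1 := lintegral_withDensity_eq_lintegral_mul
    (volume : Measure (Fin N → Fin N → ℂ))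
    (continuous_matrixGaussianPDF N N N).measurable.ennreal_ofReal hm
  simp only [Pi.mul_apply] at h1
  rw [← h1, ← map_ginibreMatrix_eq_withDensity hN, lintegral_map hm (measurable_ginibreMatrix N)]
  rfl

theorem integrable_ginibreDensity {N : ℕ} (hN : 1 ≤ N) : Integrable (ginibreDensity N) := by
  refine ⟨(continuous_ginibreDensity N).aestronglyMeasurable, ?_⟩
  rw [hasFiniteIntegral_iff_ofReal (.of_forall (ginibreDensity_nonneg N)),
    lintegral_ginibreDensity hN]
  exact ENNReal.one_lt_top

theorem integral_ginibreDensity {N : ℕ} (hN : 1 ≤ N) : ∫ z, ginibreDensity N z = 1 := by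
  rw [integral_eq_lintegral_of_nonneg_ae (.of_forall (ginibreDensity_nonneg N))
    (continuous_ginibreDensity N).aestronglyMeasurable, lintegral_ginibreDensity hN,
    ENNReal.toReal_one]

theorem integrable_mul_ginibreDensity {N : ℕ} (hN : 1 ≤ N) {f : ℂ → ℝ} (hf : Continuous f)
    {M : ℝ} (hM : ∀ z, |f z| ≤ M) : Integrable fun z => f z * ginibreDensity N z :=
  (integrable_ginibreDensity hN).bdd_mul hf.aestronglyMeasurable (.of_forall hM)

theorem mul_integral_le_integral_eigenvalueSum {N : ℕ} (hN : 1 ≤ N) {f : ℂ → ℝ}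
    (hf : Continuous f) (h0 : ∀ z, 0 ≤ f z) {M : ℝ} (hM : ∀ z, |f z| ≤ M) :
    N * ∫ z, f z * ginibreDensity N z ≤
      ∫ ω, eigenvalueSum (ginibreMatrix N ω) f ∂(ginibreNoise N) := by
  obtain ⟨n, rfl⟩ : ∃ n, N = n + 1 := ⟨N - 1, by omega⟩
  have h := lintegral_ginibreDensity_le n hf h0
  rw [← lintegral_eigenvalueSum_ginibreMatrix hN hf] at h
  have hr : ∀ z, f z * (((n + 1 : ℕ) : ℝ) * ginibreDensity (n + 1) z) =
      ((n + 1 : ℕ) : ℝ) * (f z * ginibreDensity (n + 1) z) := fun z => by ring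
  simp_rw [hr] at h
  rw [← ofReal_integral_eq_lintegral_ofReal
      ((integrable_mul_ginibreDensity hN hf hM).const_mul _)
      (.of_forall fun z => by
        have := h0 z
        have := ginibreDensity_nonneg (n + 1) z
        simp only [Pi.zero_apply]
        positivity),
    ← ofReal_integral_eq_lintegral_ofReal (integrable_eigenvalueSum_ginibreMatrix _ hf hM)
      (.of_forall fun _ => eigenvalueSum_nonneg _ h0),
    ENNReal.ofReal_le_ofReal_iff (integral_nonneg fun _ => eigenvalueSum_nonneg _ h0),
    integral_const_mul] at h
  exact h

theorem eigenvalueSum_const_add_mul {N : ℕ} (A : Matrix (Fin N) (Fin N) ℂ) (f : ℂ → ℝ)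
    (M ε : ℝ) : eigenvalueSum A (fun z => M + ε * f z) = N * M + ε * eigenvalueSum A f := by
  obtain ⟨v, hv⟩ := exists_map_univ_eq_roots_charpoly A
  rw [eigenvalueSum_eq_sum hv, eigenvalueSum_eq_sum hv, Finset.sum_add_distrib, ← Finset.mul_sum]
  simp

/-- The lower bound holds for the nonnegative functions M + f and M - f. Both sides assign NM to the
constant M, so it cancels and two opposite inequalities for f remain. -/
theorem integral_eigenvalueSum_ginibreMatrix {N : ℕ} (hN : 1 ≤ N) {f : ℂ → ℝ}
    (hf : Continuous f) {M : ℝ} (hM : ∀ z, |f z| ≤ M) :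
    ∫ ω, eigenvalueSum (ginibreMatrix N ω) f ∂(ginibreNoise N) =
      N * ∫ z, f z * ginibreDensity N z := by
  have key (ε : ℝ) (hε : |ε| = 1) : ε * (N * ∫ z, f z * ginibreDensity N z) ≤
      ε * ∫ ω, eigenvalueSum (ginibreMatrix N ω) f ∂(ginibreNoise N) := by
    have hb (z : ℂ) : |ε * f z| ≤ M := by rw [abs_mul, hε, one_mul]; exact hM z
    have h := mul_integral_le_integral_eigenvalueSum hN (f := fun z => M + ε * f z)
      (by fun_prop) (fun z => by linarith [(abs_le.1 (hb z)).1]) (M := 2 * M) (fun z => by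
        have h1 := abs_le.1 (hb z)
        exact abs_le.2 ⟨by linarith [h1.1, h1.2], by linarith [h1.2]⟩)
    simp_rw [eigenvalueSum_const_add_mul, add_mul, mul_assoc] at h
    rw [integral_add ((integrable_ginibreDensity hN).const_mul M)
        ((integrable_mul_ginibreDensity hN hf hM).const_mul ε),
      integral_add (integrable_const _)
        ((integrable_eigenvalueSum_ginibreMatrix N hf hM).const_mul ε),
      integral_const_mul, integral_ginibreDensity hN] at h
    simp only [integral_const_mul, integral_const, probReal_univ, one_smul] at h
    linarith
  have h1 := key 1 (by simp)
  have h2 := key (-1) (by simp)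
  linarith

theorem isOnePointDensity_ginibreDensity {N : ℕ} (hN : 1 ≤ N) :
    IsOnePointDensity N (ginibreDensity N) := by
  refine ⟨continuous_ginibreDensity N, fun f hf hs => ?_⟩
  obtain ⟨M, hM⟩ := hs.exists_bound_of_continuous hf
  refine ⟨integrable_eigenvalueSum_ginibreMatrix N hf hM, ?_⟩
  have hN0 : (N : ℝ) ≠ 0 := by positivity
  rw [integral_eigenvalueSum_ginibreMatrix hN hf hM]
  field_simp

/-- Smooth compactly supported test functions determine a locally integrable function almost
everywhere, and continuity removes the exceptional set. -/
theorem IsOnePointDensity.unique {N : ℕ} {R R' : ℂ → ℝ} (h : IsOnePointDensity N R)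
    (h' : IsOnePointDensity N R') : R = R' := by
  rw [← h.1.ae_eq_iff_eq (volume : Measure ℂ) h'.1]
  refine ae_eq_of_integral_contDiff_smul_eq h.1.locallyIntegrable h'.1.locallyIntegrable
    fun g hg hs => ?_
  simp only [smul_eq_mul]
  rw [← (h.2 g hg.continuous hs).2, (h'.2 g hg.continuous hs).2]

/-- With N = M + 1, N(1 - u/√N)² = (√N - u)², so the Poisson limit applies. -/
theorem tendsto_ginibreDensity_edge (u : ℝ) :
    Tendsto (fun N : ℕ => ginibreDensity N ((1 - (N : ℝ) ^ (-(1 / 2 : ℝ)) * u : ℝ) : ℂ)) atTop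
      (𝓝 (Real.pi⁻¹ * stdNormalCDF (2 * u))) := by
  rw [← tendsto_add_atTop_iff_nat 1]
  refine ((tendsto_exp_mul_sum_poisson u).const_mul Real.pi⁻¹).congr fun M => ?_
  have hN : (0 : ℝ) < (M + 1 : ℕ) := by positivity
  have h : ((M + 1 : ℕ) : ℝ) *
      ‖((1 - ((M + 1 : ℕ) : ℝ) ^ (-(1 / 2 : ℝ)) * u : ℝ) : ℂ)‖ ^ 2 =
      (Real.sqrt (M + 1 : ℕ) + -u) ^ 2 := by
    rw [Complex.norm_real, Real.norm_eq_abs, sq_abs, Real.rpow_neg hN.le, ← Real.sqrt_eq_rpow]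
    set r := Real.sqrt ((M + 1 : ℕ) : ℝ) with hr
    have hrpos : 0 < r := Real.sqrt_pos.2 hN
    rw [show ((M + 1 : ℕ) : ℝ) = r ^ 2 from (Real.sq_sqrt hN.le).symm]
    field_simp
    ring
  rw [ginibreDensity, neg_mul, h]

end

theorem lemma4p1 :
    (∀ N : ℕ, 1 ≤ N → ∃! R : ℂ → ℝ, IsOnePointDensity N R) ∧
    ∀ R : ℕ → ℂ → ℝ, (∀ N : ℕ, 1 ≤ N → IsOnePointDensity N (R N)) →
      ∀ u : ℝ,
        Tendsto (fun N : ℕ => R N ((1 - (N : ℝ) ^ (-(1 / 2 : ℝ)) * u : ℝ) : ℂ)) atTop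
          (𝓝 (Real.pi⁻¹ * stdNormalCDF (2 * u))) := by
  refine ⟨fun N hN => ⟨ginibreDensity N, isOnePointDensity_ginibreDensity hN, fun R hR =>
    hR.unique (isOnePointDensity_ginibreDensity hN)⟩, fun R hR u => ?_⟩
  refine (tendsto_ginibreDensity_edge u).congr' ?_
  filter_upwards [eventually_ge_atTop 1] with N hN
  rw [(hR N hN).unique (isOnePointDensity_ginibreDensity hN)]
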